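/- **Setting.** Let $U(\underline\theta)=W\,U_\nu(\theta_\nu)\cdots U_1(\theta_1)$, $U_l(t)=e^{-i\kappa tG_l}W_l$, be a variational circuit on $N$ qubits with $\nu$ parametrised Pauli gates: the $G_l$ are Pauli strings, the $W_l$ and $W$ fixed unitaries, and $\kappa>0$ fixes the normalisation of the angles (e.g. $\kappa=1$ or $\kappa=\tfrac12$). Let $|\psi(\underline\theta)\rangle=U(\underline\theta)|0\rangle^{\otimes N}$. Let $\mathcal H=\sum_{a=1}^r h_a\mathcal H_a$ with $r\ge 1$, $h_a\in\mathbb R$ and $p$-local Pauli strings $\mathcal H_a$, and let $O_1,\dots,O_{N_c}$, $N_c\ge1$, be $q$-local Pauli strings ($l$-local: acting non-trivially on at most $l$ qubits). Write $\langle A\rangle(\underline\theta)=\langle\psi(\underline\theta)|A|\psi(\underline\theta)\rangle$, $f_k=\langle O_k\mathcal H\rangle-\langle O_k\rangle\langle\mathcal H\rangle$, $\mathbf J_{kn}=\partial f_k/\partial\theta_n\in\mathbb C$ and $E=\langle\mathcal H\rangle$, and $\lVert h\rVert_1=\sum_a|h_a|$. One *application of the classical shadow procedure* to a state consists of $KB$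 independent runs ($K$ batches of $B$). In each run every qubit is measured in an independent, uniformly random one of the $X,Y,Z$ bases; the run with outcome $b$ gives the snapshot $\hat\rho=\bigotimes_j(3U_j^\dagger|b_j\rangle\langle b_j|U_j-\mathrm{Id})$, and $\langle A\rangle$ is estimated by the median over the batches of $\mathrm{Tr}(A\hat\rho_{(k)})$, where $\hat\rho_{(k)}$ is the mean snapshot of the batch $k$. For the energy gradient, the procedure is applied independently at the $2\nu$ configurations $\underline\theta\pm\frac{\pi}{4\kappa}\underline v_n$, where $\underline v_n$ is the $n$-th standard basis vector, to estimate all $\langle\mathcal H_a\rangle$. For the Jacobian, it is applied independently at these configurations and at $\underline\theta$, to estimate all $\langle\mathcal H_a\rangle$, $\langle O_k\rangle$, $\langle P_{ka}\rangle$, $\langle Q_{ka}\rangle$, where $P_{ka}=\frac12\{O_k,\mathcal H_a\}$ and $Q_{ka}=-\frac i2[O_k,\mathcal H_a]$ (each is $0$ or a Pauli string up to sign). The derivatives are estimated from these values by the parameter-shift rule $\partial_n\langle A\rangle=\kappa[\langle A\rangle(\underline\theta+\frac{\pi}{4\kappa}\underline v_n)-\langle A\rangle(\underline\theta-\frac{\pi}{4\kappa}\underline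 v_n)]$, which gives the estimate $\widehat{\nabla E}$ of $\nabla E=\sum_ah_a\nabla\langle\mathcal H_a\rangle$ and the estimate $\hat{\mathbf J}$ of $\mathbf J_{kn}=\sum_ah_a(\partial_n\langle P_{ka}\rangle+i\,\partial_n\langle Q_{ka}\rangle-\langle O_k\rangle\partial_n\langle\mathcal H_a\rangle-\langle\mathcal H_a\rangle\partial_n\langle O_k\rangle)$. **Statement.** Let $0<\varepsilon\le1$ and $0<\delta\le1$, and put $$\bar N_s=(2\nu+1)\,3^{p+q}\,\frac{68}{\varepsilon^2}\log\frac{6rN_c}{\delta},\qquad \bar N_s^{(\mathrm{grad})}=2\nu\,3^p\,\frac{68}{\varepsilon^2}\log\frac{2r}{\delta}.$$ There are $K,B$ and $K',B'$, depending only on $p,q,r,N_c,\nu,\varepsilon,\delta$, such that the total sample numbers $N_s=(2\nu+1)KB$ for the Jacobian and $N_s^{(\mathrm{grad})}=2\nu K'B'$ for the gradient satisfy $N_s\le\bar N_s$ and $N_s^{(\mathrm{grad})}\le\bar N_s^{(\mathrm{grad})}$, and the following holds for all $N$, all circuits, $\kappa$, $\underline\theta$, $h$, $\mathcal H_a$ and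 $O_k$ as above. 1. (Jacobian) The $f_k$ have partial derivatives at $\underline\theta$. At each of the $2\nu+1$ configurations, all the Pauli expected values listed above are, with probability at least $1-\delta$, simultaneously estimated to error $\varepsilon$. With probability at least $(1-\delta)^{2\nu+1}$, and even at least $1-\delta$ if $\nu\le N_c$, this is so at all configurations simultaneously and $|\hat{\mathbf J}_{kn}-\mathbf J_{kn}|\le14\,\kappa\,\lVert h\rVert_1\,\varepsilon$ for all $k,n$. 2. (Gradient) $E$ has partial derivatives at $\underline\theta$. At each of the $2\nu$ configurations, all $\langle\mathcal H_a\rangle$ are, with probability at least $1-\delta$, simultaneously estimated to error $\varepsilon$. With probability at least $(1-\delta)^{2\nu}$ this is so at all configurations simultaneously and $|\widehat{\nabla E}_n-\partial_nE|\le2\,\kappa\,\lVert h\rVert_1\,\varepsilon$ for all $n$. 3. (Comparison) If $\nu\ge1$, then $\bar N_s\le\frac32\,3^q\log_2(6N_c)\,\bar N_s^{(\mathrm{grad})}$ and $N_s\le4\cdot3^q\log_2(6N_c)\,N_s^{(\mathrm{grad})}$: the Jacobian is only logarithmically (in $N_c$) more expensive, up to the factor $3^q$. -/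

import Mathlib

open MeasureTheory

noncomputable section

/-! ## Qubits, Pauli strings, expected values, covariances -/

/-- Labels `{0,1}^N` of the computational basis of `N` qubits. -/
abbrev Bits (N : ℕ) : Type := Fin N → Fin 2

/-- Operators on `N` qubits, as complex `2^N × 2^N` matrices. -/
abbrev Op (N : ℕ) : Type := Matrix (Bits N) (Bits N) ℂ

/-- The matrices `Id, X, Y, Z`, indexed by `0, 1, 2, 3`. -/
def pauli : Fin 4 → Matrix (Fin 2) (Fin 2) ℂ :=
  ![1, !![0, 1; 1, 0], !![0, -Complex.I; Complex.I, 0], !![1, 0; 0, -1]]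

/-- The tensor product `A 0 ⊗ ⋯ ⊗ A (N - 1)` of single-qubit operators. -/
def tensorOp {N : ℕ} (A : Fin N → Matrix (Fin 2) (Fin 2) ℂ) : Op N :=
  Matrix.of fun x y => ∏ j, A j (x j) (y j)

/-- Pauli strings in `{Id, X, Y, Z}^{⊗ N}`, as words in `{0, 1, 2, 3}^N`. -/
abbrev PauliString (N : ℕ) : Type := Fin N → Fin 4

/-- The operator of a Pauli string. -/
def PauliString.op {N : ℕ} (s : PauliString N) : Op N := tensorOp fun j => pauli (s j)

/-- `s` is `l`-local: it acts non-trivially on at most `l` qubits. -/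
def PauliString.IsLocal {N : ℕ} (s : PauliString N) (l : ℕ) : Prop :=
  (Finset.univ.filter fun j => s j ≠ 0).card ≤ l

/-- The expected value `⟨ψ| A |ψ⟩`. -/
def expect {N : ℕ} (A : Op N) (ψ : Bits N → ℂ) : ℂ := star ψ ⬝ᵥ (A.mulVec ψ)

/-- The covariance `⟨ψ| A B |ψ⟩ - ⟨ψ| A |ψ⟩ ⟨ψ| B |ψ⟩`. -/
def covar {N : ℕ} (A B : Op N) (ψ : Bits N → ℂ) : ℂ :=
  expect (A * B) ψ - expect A ψ * expect B ψ

/-- The Hamiltonian `∑ a, h a • H a` with real coefficients `h` and Pauli strings `H`. -/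
def hamiltonian {N r : ℕ} (h : Fin r → ℝ) (H : Fin r → PauliString N) : Op N :=
  ∑ a, (h a : ℂ) • (H a).op

/-! ## Variational circuits of Pauli gates -/

/-- A circuit on `N` qubits with `ν` parametrised Pauli gates, the `l`-th of which has the
generator `gen l` and is preceded by the fixed unitary `fixed l`; the fixed unitary `last` ends
the circuit. -/
structure PauliCircuit (N ν : ℕ) where
  gen : Fin ν → PauliString N
  fixed : Fin ν → Matrix.unitaryGroup (Bits N) ℂ
  last : Matrix.unitaryGroup (Bits N) ℂ

namespace PauliCircuit

variable {N ν : ℕ}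

/-- The layer `U_l(t) = exp(-i κ t P_l) W_l`, where the positive number `κ` fixes the
normalisation of the angles (usually `κ = 1` or `κ = 1/2`). -/
def layer (C : PauliCircuit N ν) (κ : ℝ) (l : Fin ν) (t : ℝ) : Op N :=
  NormedSpace.exp ((-(Complex.I * (κ : ℂ) * (t : ℂ))) • (C.gen l).op) * (C.fixed l : Op N)

/-- The circuit `U(θ) = W U_ν(θ_ν) ⋯ U_1(θ_1)`. -/
def unitary (C : PauliCircuit N ν) (κ : ℝ) (θ : Fin ν → ℝ) : Op N :=
  (C.last : Op N) * ((List.ofFn fun l => C.layer κ l (θ l)).reverse).prod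

/-- The ansatz state `U(θ) |0⟩^{⊗ N}`. -/
def state (C : PauliCircuit N ν) (κ : ℝ) (θ : Fin ν → ℝ) : Bits N → ℂ :=
  (C.unitary κ θ).mulVec (Pi.single 0 1)

/-- The covariance function `f(θ) = ⟨O Ham⟩ - ⟨O⟩ ⟨Ham⟩` in the state at `θ`. -/
def covarFun (C : PauliCircuit N ν) (κ : ℝ) (Ham : Op N) (O : PauliString N)
    (θ : Fin ν → ℝ) : ℂ :=
  covar O.op Ham (C.state κ θ)

/-- The energy `E(θ) = ⟨ψ(θ)| Ham |ψ(θ)⟩`. -/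
def energy (C : PauliCircuit N ν) (κ : ℝ) (Ham : Op N) (θ : Fin ν → ℝ) : ℝ :=
  (expect Ham (C.state κ θ)).re

/-- The Jacobian `J k n = ∂ f_k / ∂ θ_n` at `θ` of the covariance functions of `O k`. -/
def jacobian (C : PauliCircuit N ν) (κ : ℝ) (Ham : Op N) {Nc : ℕ} (O : Fin Nc → PauliString N)
    (θ : Fin ν → ℝ) : Matrix (Fin Nc) (Fin ν) ℂ :=
  Matrix.of fun k n => deriv (fun t : ℝ => C.covarFun κ Ham (O k) (Function.update θ n t)) (θ n)

/-- The energy gradient `∂ E / ∂ θ_n` at `θ`. -/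
def energyGrad (C : PauliCircuit N ν) (κ : ℝ) (Ham : Op N) (θ : Fin ν → ℝ) : Fin ν → ℝ :=
  fun n => deriv (fun t : ℝ => C.energy κ Ham (Function.update θ n t)) (θ n)

end PauliCircuit

/-! ## Classical shadows from random single-qubit Pauli measurements -/

/-- The record of one run: the measured axis (`0, 1, 2` for `X, Y, Z`) and the outcome bit of
every qubit. -/
abbrev Record (N : ℕ) : Type := (Fin N → Fin 3) × Bits N

/-- The projector `(Id + (-1)^b σ) / 2` onto the post-measurement state `U† |b⟩⟨b| U` when a qubit
is measured along the axis `a`, `σ` being the corresponding Pauli matrix. -/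
def axisProj (a : Fin 3) (b : Fin 2) : Matrix (Fin 2) (Fin 2) ℂ :=
  (1 / 2 : ℂ) • (1 + (-1 : ℂ) ^ (b : ℕ) • pauli a.succ)

/-- The probability of a record: the axes are independent and uniform, and the outcome bits
follow the Born rule in the state `ψ`. -/
def recordProb {N : ℕ} (ψ : Bits N → ℂ) (ω : Record N) : ℝ :=
  (1 / 3 : ℝ) ^ N * (expect (tensorOp fun j => axisProj (ω.1 j) (ω.2 j)) ψ).re

/-- The law of the record of one run on the state `ψ`. -/
def recordLaw {N : ℕ} (ψ : Bits N → ℂ) : Measure (Record N) :=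
  ∑ ω, ENNReal.ofReal (recordProb ψ ω) • Measure.dirac ω

/-- The classical snapshot `⨂_j (3 U_j† |b_j⟩⟨b_j| U_j - Id)`: the image of the post-measurement
state under the inverse of the measurement channel, which is the `N`-th tensor power of the
inverse `A ↦ 3 A - Tr(A) Id` of `A ↦ (A + Tr(A) Id) / 3`. -/
def snapshot {N : ℕ} (ω : Record N) : Op N :=
  tensorOp fun j => (3 : ℂ) • axisProj (ω.1 j) (ω.2 j) - 1

/-- The data of one application of the classical shadow procedure: `K` batches of `B` records. -/
abbrev ShadowData (N K B : ℕ) : Type := Fin K × Fin B → Record N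

/-- The law of the data of one application: all `K * B` runs on `ψ` are independent. -/
def shadowLaw {N : ℕ} (K B : ℕ) (ψ : Bits N → ℂ) : Measure (ShadowData N K B) :=
  Measure.pi fun _ => recordLaw ψ

/-- The median of `K` real numbers: the mean of the two middle order statistics, which coincide
when `K` is odd (and `0` if `K = 0`). -/
def median {K : ℕ} (v : Fin K → ℝ) : ℝ :=
  if hK : 0 < K then
    (v (Tuple.sort v ⟨(K - 1) / 2, by omega⟩) + v (Tuple.sort v ⟨K / 2, by omega⟩)) / 2
  else 0

/-- The mean of the snapshots in the batch `k`. -/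
def batchMean {N K B : ℕ} (D : ShadowData N K B) (k : Fin K) : Op N :=
  (1 / (B : ℂ)) • ∑ b, snapshot (D (k, b))

/-- The median-of-means estimate of the expected value of a Hermitian operator `A`. -/
def shadowEstimate {N K B : ℕ} (D : ShadowData N K B) (A : Op N) : ℝ :=
  median fun k => (Matrix.trace (A * batchMean D k)).re

/-! ## Estimating the gradient and the Jacobian by parameter shifts -/

/-- The parameters `θ ± (π / (4 κ)) e_n`, with the sign `+` for `(n, true)`. -/
def shiftedParams {ν : ℕ} (κ : ℝ) (θ : Fin ν → ℝ) (c : Fin ν × Bool) : Fin ν → ℝ :=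
  Function.update θ c.1 (θ c.1 + (if c.2 then 1 else -1) * (Real.pi / (4 * κ)))

/-- The `2 ν + 1` configurations used for the Jacobian: `θ` itself, labelled `none`, and its
`2 ν` shifts. -/
def jacobianParams {ν : ℕ} (κ : ℝ) (θ : Fin ν → ℝ) : Option (Fin ν × Bool) → Fin ν → ℝ
  | none => θ
  | some c => shiftedParams κ θ c

/-- The law of the data for the gradient: one independent application of the classical shadow
procedure at each of the `2 ν` shifted configurations. -/
def gradientLaw {N ν : ℕ} (K B : ℕ) (C : PauliCircuit N ν) (κ : ℝ) (θ : Fin ν → ℝ) :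
    Measure (Fin ν × Bool → ShadowData N K B) :=
  Measure.pi fun c => shadowLaw K B (C.state κ (shiftedParams κ θ c))

/-- The law of the data for the Jacobian: one independent application of the classical shadow
procedure at each of the `2 ν + 1` configurations. -/
def jacobianLaw {N ν : ℕ} (K B : ℕ) (C : PauliCircuit N ν) (κ : ℝ) (θ : Fin ν → ℝ) :
    Measure (Option (Fin ν × Bool) → ShadowData N K B) :=
  Measure.pi fun c => shadowLaw K B (C.state κ (jacobianParams κ θ c))

/-- The parameter-shift estimate of `∂ ⟨A⟩ / ∂ θ_n`. -/
def derivEstimate {N ν K B : ℕ} (κ : ℝ) (D : Fin ν × Bool → ShadowData N K B) (n : Fin ν)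
    (A : Op N) : ℝ :=
  κ * (shadowEstimate (D (n, true)) A - shadowEstimate (D (n, false)) A)

/-- The estimate of the energy gradient. -/
def gradientEstimate {N ν K B r : ℕ} (κ : ℝ) (h : Fin r → ℝ) (H : Fin r → PauliString N)
    (D : Fin ν × Bool → ShadowData N K B) : Fin ν → ℝ :=
  fun n => ∑ a, h a * derivEstimate κ D n (H a).op

/-- Half the anticommutator of two Pauli strings; it is `0` or, up to its sign, a Pauli string. -/
def halfAnticomm {N : ℕ} (s t : PauliString N) : Op N :=
  (1 / 2 : ℂ) • (s.op * t.op + t.op * s.op)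

/-- `-i/2` times the commutator of two Pauli strings; it is `0` or, up to its sign, a Pauli
string. The product `s.op * t.op` is `halfAnticomm s t + i * halfComm s t`. -/
def halfComm {N : ℕ} (s t : PauliString N) : Op N :=
  (-(Complex.I / 2)) • (s.op * t.op - t.op * s.op)

/-- The estimate of the Jacobian, in which the derivatives of `⟨P_ka⟩ + i ⟨Q_ka⟩ - ⟨O_k⟩ ⟨H_a⟩`
are computed from estimated expected values of Pauli strings. -/
def jacobianEstimate {N ν K B r Nc : ℕ} (κ : ℝ) (h : Fin r → ℝ) (H : Fin r → PauliString N)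
    (O : Fin Nc → PauliString N) (D : Option (Fin ν × Bool) → ShadowData N K B) :
    Matrix (Fin Nc) (Fin ν) ℂ :=
  Matrix.of fun k n => ∑ a, (h a : ℂ) *
    ((derivEstimate κ (fun c => D (some c)) n (halfAnticomm (O k) (H a)) : ℂ)
      + Complex.I * (derivEstimate κ (fun c => D (some c)) n (halfComm (O k) (H a)) : ℂ)
      - (shadowEstimate (D none) (O k).op : ℂ)
          * (derivEstimate κ (fun c => D (some c)) n (H a).op : ℂ)
      - (shadowEstimate (D none) (H a).op : ℂ)
          * (derivEstimate κ (fun c => D (some c)) n (O k).op : ℂ))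

/-- The data of one application estimate the expected value of `A` in the state `ψ` to
precision `ε`. -/
def Accurate {N K B : ℕ} (ε : ℝ) (D : ShadowData N K B) (ψ : Bits N → ℂ) (A : Op N) : Prop :=
  |shadowEstimate D A - (expect A ψ).re| ≤ ε

/-- The data of one application estimate all Pauli strings needed for the gradient to
precision `ε`. -/
def AccurateForGradient {N K B r : ℕ} (ε : ℝ) (H : Fin r → PauliString N)
    (D : ShadowData N K B) (ψ : Bits N → ℂ) : Prop :=
  ∀ a, Accurate ε D ψ (H a).op

/-- The data of one application estimate all Pauli strings needed for the Jacobian to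
precision `ε`. -/
def AccurateForJacobian {N K B r Nc : ℕ} (ε : ℝ) (H : Fin r → PauliString N)
    (O : Fin Nc → PauliString N) (D : ShadowData N K B) (ψ : Bits N → ℂ) : Prop :=
  (∀ a, Accurate ε D ψ (H a).op) ∧ (∀ k, Accurate ε D ψ (O k).op) ∧
    ∀ k a, Accurate ε D ψ (halfAnticomm (O k) (H a)) ∧ Accurate ε D ψ (halfComm (O k) (H a))

/-- The upper bound on the number of samples for the Jacobian. -/
def jacobianCost (p q r Nc ν : ℕ) (ε δ : ℝ) : ℝ :=
  (2 * ν + 1) * 3 ^ (p + q) * (68 / ε ^ 2) * Real.log (6 * r * Nc / δ)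

/-- The upper bound on the number of samples for the energy gradient. -/
def gradientCost (p r ν : ℕ) (ε δ : ℝ) : ℝ :=
  2 * ν * 3 ^ p * (68 / ε ^ 2) * Real.log (2 * r / δ)

end

/-!
Every expected value estimated here is that of a real multiple `c • s`, `|c| ≤ 1`, of a Pauli string
`s` (`IsScaledPauli`): the product of two Pauli strings is a Pauli string up to a phase, and the real
and imaginary parts of the phase give the half anticommutator and the half commutator. On such an
operator with support on at most `l` qubits, the snapshot of one run is an unbiased estimator with
second moment at most `3 ^ l`, because everything factorises over the qubits and a single qubit
contributes `± 3` with probability `1 / 3` if its letter is not the identity.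

With batches of size `B ≥ 11 * 3 ^ l / ε ^ 2`, Chebyshev's inequality makes each batch mean wrong by
`ε` with probability at most `1 / 11`. A wrong median forces at least half of the `K` independent
batches to be wrong, which by a union bound over the subsets of batches has probability at most
`2 ^ K * (1 / 11) ^ (K / 2) ≤ exp (-K / 2)` (`measureReal_median_deviation_le`). For a cost of
`68 * 3 ^ l / ε ^ 2 * L` with `L ≥ 2 / 3` there is room for `K ≥ 4 L` such batches in spite of the
rounding (`exists_batches`), so the failure probability per operator is at most `exp (-2 L)`. With
`L = log (6 r Nc / δ)` this is quadratic in `δ / (6 r Nc)`, which suffices for a union bound over all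
operators, and over the `2 ν + 1` configurations as well if `ν ≤ Nc`. In general the configurations
are combined by independence.

As a Pauli generator squares to the identity, expected values are trigonometric polynomials
`a + b cos (2 κ t) + c sin (2 κ t)` in each parameter. This gives the parameter-shift rule. The
constant `14` of the Jacobian needs slightly more than the bounds `|⟨A⟩| ≤ 1` and `|∂⟨A⟩| ≤ 2 κ` for
Pauli strings, which would give `16`: a trigonometric polynomial bounded by `1` satisfies
`|a| + √(b² + c²) ≤ 1`, so that `2 κ |⟨A⟩| + |∂⟨A⟩| ≤ 3 κ` (`abs_add_abs_shift_le`).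
-/

/-! ### Tensor products and Pauli strings -/

theorem tensorOp_mul {N : ℕ} (A B : Fin N → Matrix (Fin 2) (Fin 2) ℂ) :
    tensorOp A * tensorOp B = tensorOp fun j => A j * B j := by
  ext x y
  simp only [tensorOp, Matrix.mul_apply, Matrix.of_apply, ← Finset.prod_mul_distrib]
  rw [Finset.prod_univ_sum]
  simp

theorem tensorOp_conjTranspose {N : ℕ} (A : Fin N → Matrix (Fin 2) (Fin 2) ℂ) :
    (tensorOp A).conjTranspose = tensorOp fun j => (A j).conjTranspose := by
  ext x y
  simp [tensorOp, Matrix.conjTranspose_apply]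

theorem tensorOp_one {N : ℕ} : tensorOp (fun _ : Fin N => 1) = 1 := by
  ext x y
  simp only [tensorOp, Matrix.of_apply, Matrix.one_apply, Finset.prod_ite_zero, funext_iff]
  simp

theorem tensorOp_smul {N : ℕ} (c : Fin N → ℂ) (A : Fin N → Matrix (Fin 2) (Fin 2) ℂ) :
    tensorOp (fun j => c j • A j) = (∏ j, c j) • tensorOp A := by
  ext x y
  simp [tensorOp, Finset.prod_mul_distrib]

theorem trace_tensorOp {N : ℕ} (A : Fin N → Matrix (Fin 2) (Fin 2) ℂ) :
    (tensorOp A).trace = ∏ j, (A j).trace := by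
  simp only [Matrix.trace, tensorOp, Matrix.diag_apply, Matrix.of_apply]
  rw [Finset.prod_univ_sum]
  simp

/-- Multilinearity of the tensor product, as a sum over all choices of one term per factor. -/
theorem tensorOp_sum {N : ℕ} {ι : Type*} [Fintype ι] [DecidableEq ι]
    (A : Fin N → ι → Matrix (Fin 2) (Fin 2) ℂ) :
    tensorOp (fun j => ∑ i, A j i) = ∑ f : Fin N → ι, tensorOp fun j => A j (f j) := by
  ext x y
  simp only [tensorOp, Matrix.of_apply, Matrix.sum_apply]
  rw [Finset.prod_univ_sum]
  simp

theorem pauli_conjTranspose (a : Fin 4) : (pauli a).conjTranspose = pauli a := by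
  fin_cases a <;> ext i j <;> fin_cases i <;> fin_cases j <;>
    simp [pauli, Matrix.conjTranspose_apply]

theorem pauli_mul_self (a : Fin 4) : pauli a * pauli a = 1 := by
  fin_cases a <;> ext i j <;> fin_cases i <;> fin_cases j <;>
    simp [pauli, Matrix.mul_apply]

/-- Up to a phase, the product of two Pauli matrices is a Pauli matrix. -/
theorem exists_pauli_mul (a b : Fin 4) :
    ∃ (c : ℂ) (d : Fin 4), ‖c‖ = 1 ∧ pauli a * pauli b = c • pauli d ∧
      (d ≠ 0 → a ≠ 0 ∨ b ≠ 0) := by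
  have hI : ‖-Complex.I‖ = 1 := by simp
  fin_cases a <;> fin_cases b
  · exact ⟨1, 0, by simp, by simp [pauli], by simp⟩
  · exact ⟨1, 1, by simp, by simp [pauli], by simp⟩
  · exact ⟨1, 2, by simp, by simp [pauli], by simp⟩
  · exact ⟨1, 3, by simp, by simp [pauli], by simp⟩
  · exact ⟨1, 1, by simp, by simp [pauli], by simp⟩
  · exact ⟨1, 0, by simp, by simpa [pauli] using pauli_mul_self 1, by simp⟩
  · exact ⟨Complex.I, 3, by simp, by
      ext i j; fin_cases i <;> fin_cases j <;> simp [pauli], by simp⟩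
  · exact ⟨-Complex.I, 2, hI, by
      ext i j; fin_cases i <;> fin_cases j <;> simp [pauli], by simp⟩
  · exact ⟨1, 2, by simp, by simp [pauli], by simp⟩
  · exact ⟨-Complex.I, 3, hI, by
      ext i j; fin_cases i <;> fin_cases j <;> simp [pauli], by simp⟩
  · exact ⟨1, 0, by simp, by simpa [pauli] using pauli_mul_self 2, by simp⟩
  · exact ⟨Complex.I, 1, by simp, by
      ext i j; fin_cases i <;> fin_cases j <;> simp [pauli], by simp⟩
  · exact ⟨1, 3, by simp, by simp [pauli], by simp⟩
  · exact ⟨Complex.I, 2, by simp, by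
      ext i j; fin_cases i <;> fin_cases j <;> simp [pauli], by simp⟩
  · exact ⟨-Complex.I, 1, hI, by
      ext i j; fin_cases i <;> fin_cases j <;> simp [pauli], by simp⟩
  · exact ⟨1, 0, by simp, by simpa [pauli] using pauli_mul_self 3, by simp⟩

theorem PauliString.op_conjTranspose {N : ℕ} (s : PauliString N) :
    s.op.conjTranspose = s.op := by
  simp only [PauliString.op, tensorOp_conjTranspose, pauli_conjTranspose]

theorem PauliString.op_mul_self {N : ℕ} (s : PauliString N) : s.op * s.op = 1 := by
  simp only [PauliString.op, tensorOp_mul, pauli_mul_self, tensorOp_one]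

/-- Up to a phase, the product of two Pauli strings is a Pauli string, and localities add up. -/
theorem PauliString.exists_op_mul {N : ℕ} {s t : PauliString N} {k l : ℕ} (hs : s.IsLocal k)
    (ht : t.IsLocal l) :
    ∃ (c : ℂ) (u : PauliString N), ‖c‖ = 1 ∧ s.op * t.op = c • u.op ∧ u.IsLocal (k + l) := by
  choose c d hc hcd hd using exists_pauli_mul
  refine ⟨∏ j, c (s j) (t j), fun j => d (s j) (t j), by simp [hc], ?_, ?_⟩
  · simp only [PauliString.op, tensorOp_mul, hcd, tensorOp_smul]
  · refine le_trans (Finset.card_le_card ?_) ((Finset.card_union_le _ _).trans (add_le_add hs ht))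
    intro j hj
    simp only [Finset.mem_filter, Finset.mem_univ, true_and, Finset.mem_union] at hj ⊢
    exact hd _ _ hj

/-- `A` is a real multiple `c • s` of an `l`-local Pauli string with `|c| ≤ 1`. This covers `0` and
`± s`, hence the symmetric and antisymmetric parts of a product of two Pauli strings. -/
def IsScaledPauli {N : ℕ} (A : Op N) (l : ℕ) : Prop :=
  ∃ (c : ℝ) (s : PauliString N), |c| ≤ 1 ∧ s.IsLocal l ∧ A = (c : ℂ) • s.op

theorem PauliString.IsLocal.isScaledPauli {N : ℕ} {s : PauliString N} {l : ℕ}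
    (hs : s.IsLocal l) : IsScaledPauli s.op l :=
  ⟨1, s, by simp, hs, by simp⟩

theorem IsScaledPauli.mono {N : ℕ} {A : Op N} {k l : ℕ} (h : IsScaledPauli A k) (hkl : k ≤ l) :
    IsScaledPauli A l := by
  obtain ⟨c, s, hc, hs, hA⟩ := h
  exact ⟨c, s, hc, le_trans hs hkl, hA⟩

theorem PauliString.mul_op_eq_star {N : ℕ} {s t u : PauliString N} {c : ℂ}
    (h : s.op * t.op = c • u.op) : t.op * s.op = star c • u.op := by
  have := congrArg Matrix.conjTranspose h
  simpa only [Matrix.conjTranspose_mul, Matrix.conjTranspose_smul,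
    PauliString.op_conjTranspose] using this

/-- If `s * t` is the phase `c` times a Pauli string `u`, then the half anticommutator is
`Re c • u`. -/
theorem isScaledPauli_halfAnticomm {N : ℕ} {s t : PauliString N} {k l : ℕ} (hs : s.IsLocal k)
    (ht : t.IsLocal l) : IsScaledPauli (halfAnticomm s t) (k + l) := by
  obtain ⟨c, u, hc, hcu, hu⟩ := PauliString.exists_op_mul hs ht
  refine ⟨c.re, u, hc ▸ Complex.abs_re_le_norm c, hu, ?_⟩
  rw [halfAnticomm, PauliString.mul_op_eq_star hcu, hcu, ← add_smul, smul_smul]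
  congr 1
  apply Complex.ext
  · simp
    ring
  · simp

/-- If `s * t` is the phase `c` times a Pauli string `u`, then `-i/2` times the commutator is
`Im c • u`. -/
theorem isScaledPauli_halfComm {N : ℕ} {s t : PauliString N} {k l : ℕ} (hs : s.IsLocal k)
    (ht : t.IsLocal l) : IsScaledPauli (halfComm s t) (k + l) := by
  obtain ⟨c, u, hc, hcu, hu⟩ := PauliString.exists_op_mul hs ht
  refine ⟨c.im, u, hc ▸ Complex.abs_im_le_norm c, hu, ?_⟩
  rw [halfComm, PauliString.mul_op_eq_star hcu, hcu, ← sub_smul, smul_smul]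
  congr 1
  apply Complex.ext
  · simp
    ring
  · simp

theorem halfAnticomm_add_halfComm {N : ℕ} (s t : PauliString N) :
    halfAnticomm s t + Complex.I • halfComm s t = s.op * t.op := by
  rw [halfAnticomm, halfComm, smul_smul]
  have : Complex.I * -(Complex.I / 2) = 1 / 2 := by
    linear_combination (-1 / 2 : ℂ) * Complex.I_mul_I
  rw [this]
  module

/-! ### Expected values -/

theorem expect_add {N : ℕ} (A B : Op N) (ψ : Bits N → ℂ) :
    expect (A + B) ψ = expect A ψ + expect B ψ := by
  simp [expect, Matrix.add_mulVec, dotProduct_add]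

theorem expect_sub {N : ℕ} (A B : Op N) (ψ : Bits N → ℂ) :
    expect (A - B) ψ = expect A ψ - expect B ψ := by
  simp [expect, Matrix.sub_mulVec, dotProduct_sub]

theorem expect_smul {N : ℕ} (c : ℂ) (A : Op N) (ψ : Bits N → ℂ) :
    expect (c • A) ψ = c * expect A ψ := by
  simp [expect, Matrix.smul_mulVec]

theorem expect_sum {N : ℕ} {ι : Type*} (s : Finset ι) (A : ι → Op N) (ψ : Bits N → ℂ) :
    expect (∑ i ∈ s, A i) ψ = ∑ i ∈ s, expect (A i) ψ := by
  simp [expect, Matrix.sum_mulVec, dotProduct_sum]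

theorem expect_mulVec {N : ℕ} (A U : Op N) (ψ : Bits N → ℂ) :
    expect A (U.mulVec ψ) = expect (U.conjTranspose * A * U) ψ := by
  simp only [expect, Matrix.star_mulVec, ← Matrix.mulVec_mulVec, ← Matrix.dotProduct_mulVec]

/-- `0 ≤ ⟨Bᴴ B⟩`. -/
theorem expect_conjTranspose_mul_self_nonneg {N : ℕ} (B : Op N) (ψ : Bits N → ℂ) :
    0 ≤ (expect (B.conjTranspose * B) ψ).re := by
  have h := expect_mulVec 1 B ψ
  rw [mul_one] at h
  rw [← h, expect, Matrix.one_mulVec]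
  simp only [dotProduct, Pi.star_apply, Complex.re_sum]
  refine Finset.sum_nonneg fun x _ => ?_
  rw [Complex.star_def, ← Complex.normSq_eq_conj_mul_self, Complex.ofReal_re]
  exact Complex.normSq_nonneg _

theorem expect_eq_ofReal_re {N : ℕ} {A : Op N} (hA : A.conjTranspose = A) (ψ : Bits N → ℂ) :
    expect A ψ = ((expect A ψ).re : ℂ) := by
  have h : star (expect A ψ) = expect A ψ := by
    rw [expect, ← Matrix.star_dotProduct_star, star_star, Matrix.star_mulVec, hA,
      ← Matrix.dotProduct_mulVec]
  exact (Complex.conj_eq_iff_re.1 h).symm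

theorem IsScaledPauli.expect_eq {N : ℕ} {A : Op N} {l : ℕ} (hA : IsScaledPauli A l)
    (ψ : Bits N → ℂ) : expect A ψ = ((expect A ψ).re : ℂ) := by
  obtain ⟨c, s, -, -, rfl⟩ := hA
  refine expect_eq_ofReal_re ?_ ψ
  rw [Matrix.conjTranspose_smul, PauliString.op_conjTranspose]
  simp

/-- As `(1 ∓ s)ᴴ (1 ∓ s) = 2 (1 ∓ s)`, expected values of Pauli strings lie in `[-1, 1]`. -/
theorem abs_expect_op_le {N : ℕ} (s : PauliString N) {ψ : Bits N → ℂ} (hψ : expect 1 ψ = 1) :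
    |(expect s.op ψ).re| ≤ 1 := by
  have h₁ := expect_conjTranspose_mul_self_nonneg (1 - s.op) ψ
  have h₂ := expect_conjTranspose_mul_self_nonneg (1 + s.op) ψ
  have e₁ : (1 - s.op).conjTranspose * (1 - s.op) = (2 : ℂ) • (1 - s.op) := by
    simp only [Matrix.conjTranspose_sub, Matrix.conjTranspose_one, PauliString.op_conjTranspose,
      sub_mul, mul_sub, one_mul, mul_one, PauliString.op_mul_self]
    module
  have e₂ : (1 + s.op).conjTranspose * (1 + s.op) = (2 : ℂ) • (1 + s.op) := by
    simp only [Matrix.conjTranspose_add, Matrix.conjTranspose_one, PauliString.op_conjTranspose,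
      add_mul, mul_add, one_mul, mul_one, PauliString.op_mul_self]
    module
  rw [e₁, expect_smul, expect_sub, hψ] at h₁
  rw [e₂, expect_smul, expect_add, hψ] at h₂
  simp only [Complex.mul_re, Complex.sub_re, Complex.add_re, Complex.one_re, Complex.re_ofNat,
    Complex.im_ofNat, zero_mul, sub_zero] at h₁ h₂
  rw [abs_le]
  constructor <;> linarith

/-! ### The median of means -/

/-- Splitting the index set of an i.i.d. family into batches makes the batches i.i.d. -/
theorem measurePreserving_curry_pi {ι κ Ω : Type*} [Fintype ι] [Fintype κ] [MeasurableSpace Ω]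
    (μ : Measure Ω) [IsProbabilityMeasure μ] :
    MeasurePreserving (fun (D : ι × κ → Ω) (i : ι) (j : κ) => D (i, j))
      (Measure.pi fun _ => μ) (Measure.pi fun _ => Measure.pi fun _ => μ) := by
  have h : MeasurePreserving (MeasurableEquiv.curry ι κ Ω).symm
      (Measure.pi fun _ : ι => Measure.pi fun _ : κ => μ) (Measure.pi fun _ : ι × κ => μ) := by
    refine ⟨MeasurableEquiv.measurable _, (Measure.pi_eq fun s hs => ?_).symm⟩
    rw [MeasurableEquiv.map_apply]
    have hpre : (MeasurableEquiv.curry ι κ Ω).symm ⁻¹' (Set.univ.pi s) =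
        Set.univ.pi fun i => Set.univ.pi fun j => s (i, j) := by
      ext D
      simp only [Set.mem_preimage, Set.mem_univ_pi, Prod.forall]
      rfl
    rw [hpre]
    simp only [Measure.pi_pi, Fintype.prod_prod_type]
  exact h.symm

/-- If the median of `v` deviates from `m` by more than `ε`, then so do at least half of the
entries of `v`. -/
theorem exists_finset_of_lt_abs_median_sub {K : ℕ} (hK : 0 < K) (v : Fin K → ℝ) (m ε : ℝ)
    (h : ε < |median v - m|) :
    ∃ S : Finset (Fin K), K ≤ 2 * S.card ∧ ∀ k ∈ S, ε ≤ |v k - m| := by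
  have hmono := Tuple.monotone_sort v
  set σ := Tuple.sort v with hσ
  have hmid : v (σ ⟨(K - 1) / 2, by omega⟩) ≤ v (σ ⟨K / 2, by omega⟩) :=
    hmono (Fin.mk_le_mk.2 (by omega))
  have hmed : median v = (v (σ ⟨(K - 1) / 2, by omega⟩) + v (σ ⟨K / 2, by omega⟩)) / 2 := by
    rw [median, dif_pos hK]
  rcases lt_abs.1 h with h | h
  · refine ⟨(Finset.Ici (⟨K / 2, by omega⟩ : Fin K)).map σ.toEmbedding, ?_, ?_⟩
    · simp only [Finset.card_map, Fin.card_Ici]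
      omega
    · intro k hk
      obtain ⟨i, hi, rfl⟩ := Finset.mem_map.1 hk
      have : v (σ ⟨K / 2, by omega⟩) ≤ v (σ i) := hmono (Finset.mem_Ici.1 hi)
      refine le_trans ?_ (le_abs_self _)
      simp only [Equiv.coe_toEmbedding]
      linarith
  · refine ⟨(Finset.Iic (⟨(K - 1) / 2, by omega⟩ : Fin K)).map σ.toEmbedding, ?_, ?_⟩
    · simp only [Finset.card_map, Fin.card_Iic]
      omega
    · intro k hk
      obtain ⟨i, hi, rfl⟩ := Finset.mem_map.1 hk
      have : v (σ i) ≤ v (σ ⟨(K - 1) / 2, by omega⟩) := hmono (Finset.mem_Iic.1 hi)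
      refine le_trans ?_ (neg_le_abs _)
      simp only [Equiv.coe_toEmbedding]
      linarith

/-- Chebyshev's inequality for the empirical mean of `B` independent samples of `X`. -/
theorem measureReal_mean_deviation_le {Ω : Type*} [MeasurableSpace Ω] (μ : Measure Ω)
    [IsProbabilityMeasure μ] {X : Ω → ℝ} (hX : MemLp X 2 μ) {B : ℕ} (hB : 0 < B) {ε V : ℝ}
    (hε : 0 < ε) (hV : ∫ ω, X ω ^ 2 ∂μ ≤ V) :
    (Measure.pi fun _ : Fin B => μ).real {D | ε ≤ |(1 / (B : ℝ)) * ∑ b, X (D b) - ∫ ω, X ω ∂μ|}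
      ≤ V / (B * ε ^ 2) := by
  have hB' : (0 : ℝ) < B := by exact_mod_cast hB
  have hmp : ∀ b : Fin B, MeasurePreserving (Function.eval b) (Measure.pi fun _ : Fin B => μ) μ :=
    fun b => measurePreserving_eval _ b
  have hXb : ∀ b : Fin B, MemLp (fun D : Fin B → Ω => X (D b)) 2 (Measure.pi fun _ => μ) :=
    fun b => hX.comp_measurePreserving (hmp b)
  have hsum : MemLp (∑ b : Fin B, fun D : Fin B → Ω => X (D b)) 2 (Measure.pi fun _ => μ) :=
    memLp_finsetSum' _ fun b _ => hXb b
  have hint : ∫ D, (∑ b : Fin B, fun D : Fin B → Ω => X (D b)) D ∂(Measure.pi fun _ => μ)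
      = B * ∫ ω, X ω ∂μ := by
    simp only [Finset.sum_apply]
    rw [integral_finsetSum _ fun b _ => (hXb b).integrable one_le_two]
    have : ∀ b : Fin B, ∫ D : Fin B → Ω, X (D b) ∂(Measure.pi fun _ => μ) = ∫ ω, X ω ∂μ := by
      intro b
      have h := integral_map (f := X) (hmp b).measurable.aemeasurable
        (by rw [(hmp b).map_eq]; exact hX.1)
      rw [(hmp b).map_eq] at h
      exact h.symm
    simp [this]
  have hvar : ProbabilityTheory.variance (∑ b : Fin B, fun D : Fin B → Ω => X (D b))
      (Measure.pi fun _ => μ) ≤ B * V := by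
    rw [ProbabilityTheory.variance_sum_pi fun _ => hX]
    have hle : ProbabilityTheory.variance X μ ≤ V :=
      (ProbabilityTheory.variance_le_expectation_sq hX.1).trans hV
    simpa using mul_le_mul_of_nonneg_left hle hB'.le
  have hcheb := ProbabilityTheory.meas_ge_le_variance_div_sq hsum (mul_pos hB' hε)
  have hset : {D : Fin B → Ω | ε ≤ |(1 / (B : ℝ)) * ∑ b, X (D b) - ∫ ω, X ω ∂μ|} =
      {D | B * ε ≤ |(∑ b : Fin B, fun D : Fin B → Ω => X (D b)) D
        - ∫ D, (∑ b : Fin B, fun D : Fin B → Ω => X (D b)) D ∂(Measure.pi fun _ => μ)|} := by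
    ext D
    rw [hint]
    simp only [Set.mem_ofPred_eq, Finset.sum_apply]
    have : (∑ b, X (D b)) - B * ∫ ω, X ω ∂μ
        = B * ((1 / (B : ℝ)) * ∑ b, X (D b) - ∫ ω, X ω ∂μ) := by
      field_simp
    rw [this, abs_mul, abs_of_pos hB', mul_le_mul_iff_right₀ hB']
  rw [hset]
  refine (ENNReal.toReal_le_of_le_ofReal ?_ hcheb).trans ?_
  · exact div_nonneg (ProbabilityTheory.variance_nonneg _ _) (sq_nonneg _)
  · calc _ ≤ B * V / (B * ε) ^ 2 := by gcongr
      _ = V / (B * ε ^ 2) := by field_simp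

/-- If `K` independent events have probability at most `1 / 11` each, then at least half of them
occur with probability at most `exp (-K / 2)`. -/
theorem measureReal_half_le {Ω : Type*} [MeasurableSpace Ω] (μ : Measure Ω)
    [IsProbabilityMeasure μ] {K : ℕ} {s : Set Ω} (hs : μ.real s ≤ 1 / 11) :
    (Measure.pi fun _ : Fin K => μ).real
      {D | ∃ S : Finset (Fin K), K ≤ 2 * S.card ∧ ∀ k ∈ S, D k ∈ s} ≤ Real.exp (-(K / 2)) := by
  classical
  have hE0 : 0 ≤ μ.real s := measureReal_nonneg
  have hroot : 0 ≤ Real.sqrt (μ.real s) := Real.sqrt_nonneg _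
  have hroot1 : Real.sqrt (μ.real s) ≤ 1 := Real.sqrt_le_one.2 (by linarith)
  have hbox : ∀ S : Finset (Fin K), (Measure.pi fun _ : Fin K => μ).real
      {D | ∀ k ∈ S, D k ∈ s} = μ.real s ^ S.card := by
    intro S
    have : {D : Fin K → Ω | ∀ k ∈ S, D k ∈ s} =
        Set.univ.pi fun k => if k ∈ S then s else Set.univ := by
      ext D
      simp only [Set.mem_ofPred_eq, Set.mem_univ_pi]
      refine forall_congr' fun k => ?_
      by_cases hk : k ∈ S <;> simp [hk]
    rw [this, measureReal_def, Measure.pi_pi, ENNReal.toReal_prod]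
    have : ∀ k, (μ (if k ∈ S then s else Set.univ)).toReal
        = if k ∈ S then μ.real s else 1 := by
      intro k; split_ifs <;> simp [measureReal_def]
    simp [this]
  calc _ ≤ (Measure.pi fun _ : Fin K => μ).real
        (⋃ S ∈ Finset.univ.filter (fun S : Finset (Fin K) => K ≤ 2 * S.card),
          {D | ∀ k ∈ S, D k ∈ s}) := by
        refine measureReal_mono ?_ (measure_ne_top _ _)
        rintro D ⟨S, hS, hD⟩
        simp only [Set.mem_iUnion]
        exact ⟨S, by simpa using hS, hD⟩
    _ ≤ ∑ S ∈ Finset.univ.filter (fun S : Finset (Fin K) => K ≤ 2 * S.card),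
          μ.real s ^ S.card := by
        refine (measureReal_biUnion_finset_le _ _).trans ?_
        simp only [hbox, le_refl]
    _ ≤ ∑ S ∈ Finset.univ.filter (fun S : Finset (Fin K) => K ≤ 2 * S.card),
          Real.sqrt (μ.real s) ^ K := by
        refine Finset.sum_le_sum fun S hS => ?_
        have hS' : K ≤ 2 * S.card := by simpa using hS
        calc μ.real s ^ S.card = Real.sqrt (μ.real s) ^ (2 * S.card) := by
              rw [pow_mul, Real.sq_sqrt hE0]
          _ ≤ _ := pow_le_pow_of_le_one hroot hroot1 hS'
    _ ≤ 2 ^ K * Real.sqrt (μ.real s) ^ K := by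
        rw [Finset.sum_const, nsmul_eq_mul]
        gcongr
        calc ((Finset.univ.filter (fun S : Finset (Fin K) => K ≤ 2 * S.card)).card : ℝ)
            ≤ ((Finset.univ : Finset (Finset (Fin K))).card : ℝ) := by
              exact_mod_cast Finset.card_le_card (Finset.filter_subset _ _)
          _ = 2 ^ K := by simp
    _ ≤ Real.exp (-(1 / 2)) ^ K := by
        rw [← mul_pow]
        refine pow_le_pow_left₀ (by positivity) ?_ K
        -- `(2 √η)² = 4 η ≤ 4 / 11 ≤ exp (-1)`
        refine (pow_le_pow_iff_left₀ (by positivity) (Real.exp_pos _).le two_ne_zero).1 ?_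
        rw [mul_pow, Real.sq_sqrt hE0, ← Real.exp_nat_mul]
        have he : (4 / 11 : ℝ) ≤ Real.exp (-1) := by
          rw [Real.exp_neg, ← one_div, div_le_div_iff₀ (by norm_num) (Real.exp_pos _)]
          linarith [Real.exp_one_lt_d9]
        have : ((2 : ℕ) : ℝ) * -(1 / 2) = -1 := by norm_num
        rw [this]
        linarith
    _ = Real.exp (-(K / 2)) := by
        rw [← Real.exp_nat_mul]; ring_nf

/-- The median of the means of `K` batches of `B` samples of `X` deviates from the expectation
of `X` by more than `ε` with probability at most `exp (-K / 2)`, once `B` is at least `11 / ε ^ 2`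
times the second moment of `X`. -/
theorem measureReal_median_deviation_le {Ω : Type*} [MeasurableSpace Ω] (μ : Measure Ω)
    [IsProbabilityMeasure μ] {X : Ω → ℝ} (hX : MemLp X 2 μ) {K B : ℕ} (hK : 0 < K) {ε V : ℝ}
    (hε : 0 < ε) (hB : 0 < B) (hVB : 11 * V ≤ B * ε ^ 2) (hV : ∫ ω, X ω ^ 2 ∂μ ≤ V) :
    (Measure.pi fun _ : Fin K × Fin B => μ).real
      {D | ε < |(median fun k => (1 / (B : ℝ)) * ∑ b, X (D (k, b))) - ∫ ω, X ω ∂μ|}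
      ≤ Real.exp (-(K / 2)) := by
  set s : Set (Fin B → Ω) := {D | ε ≤ |(1 / (B : ℝ)) * ∑ b, X (D b) - ∫ ω, X ω ∂μ|} with hs
  have hs1 : (Measure.pi fun _ : Fin B => μ).real s ≤ 1 / 11 := by
    refine (measureReal_mean_deviation_le μ hX hB hε hV).trans ?_
    have : 0 < (B : ℝ) * ε ^ 2 := by positivity
    rw [div_le_div_iff₀ this (by norm_num)]
    linarith
  refine le_trans ?_ (measureReal_half_le (K := K) (Measure.pi fun _ : Fin B => μ) hs1)
  have hmp := measurePreserving_curry_pi (ι := Fin K) (κ := Fin B) μ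
  rw [← hmp.map_eq, measureReal_def, measureReal_def]
  refine ENNReal.toReal_mono (measure_ne_top _ _) ?_
  refine le_trans (measure_mono ?_) (Measure.le_map_apply hmp.measurable.aemeasurable _)
  intro D hD
  exact exists_finset_of_lt_abs_median_sub hK _ _ _ hD

/-! ### Moments of the snapshots -/

theorem axisProj_conjTranspose (a : Fin 3) (b : Fin 2) :
    (axisProj a b).conjTranspose = axisProj a b := by
  simp [axisProj, Matrix.conjTranspose_smul, pauli_conjTranspose]

theorem axisProj_mul_self (a : Fin 3) (b : Fin 2) : axisProj a b * axisProj a b = axisProj a b := by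
  have hb : ((-1 : ℂ) ^ (b : ℕ)) * (-1) ^ (b : ℕ) = 1 := by
    rw [← mul_pow]; simp
  simp only [axisProj, smul_mul_smul_comm, add_mul, mul_add, one_mul, mul_one, pauli_mul_self, hb]
  module

theorem recordProb_nonneg {N : ℕ} (ψ : Bits N → ℂ) (ω : Record N) : 0 ≤ recordProb ψ ω := by
  refine mul_nonneg (by positivity) ?_
  have h := expect_conjTranspose_mul_self_nonneg
    (tensorOp fun j => axisProj (ω.1 j) (ω.2 j)) ψ
  simpa only [tensorOp_conjTranspose, tensorOp_mul, axisProj_conjTranspose,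
    axisProj_mul_self] using h

/-- The measurement is a product over the qubits, so the expectation of a product of single-qubit
functions `g j` of the record is the expected value of a tensor product. -/
theorem sum_recordProb_mul_prod {N : ℕ} (ψ : Bits N → ℂ) (g : Fin N → Fin 3 × Fin 2 → ℝ) :
    ∑ ω : Record N, recordProb ψ ω * ∏ j, g j (ω.1 j, ω.2 j) =
      (expect (tensorOp fun j => ∑ i, ((1 / 3 * g j i : ℝ) : ℂ) • axisProj i.1 i.2) ψ).re := by
  rw [tensorOp_sum, expect_sum, Complex.re_sum,
    ← (Equiv.arrowProdEquivProdArrow (Fin N) (fun _ => Fin 3) (fun _ => Fin 2)).sum_comp]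
  refine Finset.sum_congr rfl fun f _ => ?_
  rw [tensorOp_smul, expect_smul, ← Complex.ofReal_prod, Complex.re_ofReal_mul,
    Finset.prod_mul_distrib]
  simp only [recordProb, Equiv.arrowProdEquivProdArrow, Equiv.coe_fn_mk, Finset.prod_const,
    Finset.card_univ, Fintype.card_fin, Prod.mk.eta]
  ring

/-- The factor that a qubit with the record `i` (axis and outcome) contributes to the shadow
estimate of a Pauli string with letter `σ` at this qubit. -/
def shadowFactor (σ : Fin 4) (i : Fin 3 × Fin 2) : ℝ :=
  if σ = 0 then 1 else if σ = i.1.succ then 3 * (-1) ^ (i.2 : ℕ) else 0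

theorem trace_pauli_mul_snapshot (σ : Fin 4) (a : Fin 3) (b : Fin 2) :
    (pauli σ * ((3 : ℂ) • axisProj a b - 1)).trace = (shadowFactor σ (a, b) : ℂ) := by
  simp only [axisProj, Matrix.trace_fin_two, Matrix.mul_apply, Fin.sum_univ_two, Matrix.sub_apply,
    Matrix.smul_apply, Matrix.add_apply]
  fin_cases σ <;> fin_cases a <;> fin_cases b <;>
    simp [pauli, shadowFactor, Fin.ext_iff] <;> ring_nf <;> simp

theorem sum_axisProj : ∑ i : Fin 3 × Fin 2, ((1 / 3 * 1 : ℝ) : ℂ) • axisProj i.1 i.2 = 1 := by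
  simp only [Fintype.sum_prod_type, Fin.sum_univ_three, Fin.sum_univ_two, axisProj]
  push_cast
  simp only [Fin.val_zero, Fin.val_one, pow_zero, pow_one]
  module

theorem sum_shadowFactor_axisProj (σ : Fin 4) :
    ∑ i, ((1 / 3 * shadowFactor σ i : ℝ) : ℂ) • axisProj i.1 i.2 = pauli σ := by
  simp only [Fintype.sum_prod_type, Fin.sum_univ_three, Fin.sum_univ_two, axisProj]
  fin_cases σ <;> ext i j <;> fin_cases i <;> fin_cases j <;>
    simp [pauli, shadowFactor, Fin.ext_iff] <;> ring

theorem sum_shadowFactor_sq_axisProj (σ : Fin 4) :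
    ∑ i, ((1 / 3 * shadowFactor σ i ^ 2 : ℝ) : ℂ) • axisProj i.1 i.2 =
      ((if σ = 0 then 1 else 3 : ℝ) : ℂ) • 1 := by
  simp only [Fintype.sum_prod_type, Fin.sum_univ_three, Fin.sum_univ_two, axisProj]
  fin_cases σ <;> ext i j <;> fin_cases i <;> fin_cases j <;>
    simp [pauli, shadowFactor, Fin.ext_iff] <;> ring

theorem sum_recordProb {N : ℕ} {ψ : Bits N → ℂ} (hψ : expect 1 ψ = 1) :
    ∑ ω : Record N, recordProb ψ ω = 1 := by
  have h := sum_recordProb_mul_prod ψ fun _ _ => 1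
  simp only [Finset.prod_const_one, mul_one] at h
  have h' := sum_axisProj
  rw [mul_one] at h'
  rw [h, h', tensorOp_one, hψ, Complex.one_re]

theorem isProbabilityMeasure_recordLaw {N : ℕ} {ψ : Bits N → ℂ} (hψ : expect 1 ψ = 1) :
    IsProbabilityMeasure (recordLaw ψ) := by
  constructor
  simp only [recordLaw, Measure.coe_finsetSum, Finset.sum_apply, Measure.smul_apply,
    measure_univ, smul_eq_mul, mul_one]
  rw [← ENNReal.ofReal_sum_of_nonneg fun ω _ => recordProb_nonneg ψ ω, sum_recordProb hψ,
    ENNReal.ofReal_one]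

theorem integral_recordLaw {N : ℕ} (ψ : Bits N → ℂ) (X : Record N → ℝ) :
    ∫ ω, X ω ∂recordLaw ψ = ∑ ω, recordProb ψ ω * X ω := by
  rw [recordLaw, integral_finsetSum_measure]
  · refine Finset.sum_congr rfl fun ω _ => ?_
    rw [integral_smul_measure, integral_dirac, ENNReal.toReal_ofReal (recordProb_nonneg ψ ω),
      smul_eq_mul]
  · intro ω _
    exact (integrable_dirac (by simp)).smul_measure ENNReal.ofReal_ne_top

theorem trace_op_mul_snapshot {N : ℕ} (s : PauliString N) (ω : Record N) :
    (s.op * snapshot ω).trace = ((∏ j, shadowFactor (s j) (ω.1 j, ω.2 j) : ℝ) : ℂ) := by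
  rw [PauliString.op, snapshot, tensorOp_mul, trace_tensorOp]
  push_cast
  exact Finset.prod_congr rfl fun j _ => trace_pauli_mul_snapshot _ _ _

/-- Snapshots are unbiased. -/
theorem integral_trace_mul_snapshot {N : ℕ} {A : Op N} {l : ℕ} (hA : IsScaledPauli A l)
    (ψ : Bits N → ℂ) :
    ∫ ω, (A * snapshot ω).trace.re ∂recordLaw ψ = (expect A ψ).re := by
  obtain ⟨c, s, -, -, rfl⟩ := hA
  have h := sum_recordProb_mul_prod ψ fun j => shadowFactor (s j)
  simp only [sum_shadowFactor_axisProj] at h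
  rw [integral_recordLaw, expect_smul, Complex.re_ofReal_mul, PauliString.op, ← h, Finset.mul_sum]
  refine Finset.sum_congr rfl fun ω _ => ?_
  rw [Matrix.smul_mul, Matrix.trace_smul, smul_eq_mul, Complex.re_ofReal_mul, ← PauliString.op,
    trace_op_mul_snapshot, Complex.ofReal_re]
  ring

/-- The snapshot estimate of a Pauli string on `w` qubits is `± 3 ^ w` with probability `3 ^ (-w)`,
and `0` otherwise. -/
theorem integral_sq_trace_mul_snapshot_le {N : ℕ} {A : Op N} {l : ℕ} (hA : IsScaledPauli A l)
    {ψ : Bits N → ℂ} (hψ : expect 1 ψ = 1) :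
    ∫ ω, (A * snapshot ω).trace.re ^ 2 ∂recordLaw ψ ≤ 3 ^ l := by
  obtain ⟨c, s, hc, hs, rfl⟩ := hA
  have h := sum_recordProb_mul_prod ψ fun j i => shadowFactor (s j) i ^ 2
  simp only [sum_shadowFactor_sq_axisProj, tensorOp_smul, tensorOp_one, expect_smul, hψ, mul_one,
    ← Complex.ofReal_prod, Complex.ofReal_re, Finset.prod_pow] at h
  have hprod : (∏ j, if s j = 0 then 1 else 3 : ℝ) ≤ 3 ^ l := by
    rw [Finset.prod_ite]
    simp only [Finset.prod_const_one, Finset.prod_const, one_mul]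
    exact pow_le_pow_right₀ (by norm_num) hs
  have hc2 : c ^ 2 ≤ 1 := by rw [← sq_abs]; exact pow_le_one₀ (abs_nonneg _) hc
  have hint : ∫ ω, (((c : ℂ) • s.op) * snapshot ω).trace.re ^ 2 ∂recordLaw ψ =
      c ^ 2 * ∏ j, if s j = 0 then 1 else 3 := by
    rw [← h, integral_recordLaw, Finset.mul_sum]
    refine Finset.sum_congr rfl fun ω _ => ?_
    rw [Matrix.smul_mul, Matrix.trace_smul, smul_eq_mul, Complex.re_ofReal_mul,
      trace_op_mul_snapshot, Complex.ofReal_re]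
    ring
  rw [hint]
  have : (0 : ℝ) ≤ ∏ j, if s j = 0 then 1 else 3 :=
    Finset.prod_nonneg fun j _ => by split_ifs <;> norm_num
  nlinarith

theorem trace_mul_batchMean_re {N K B : ℕ} (A : Op N) (D : ShadowData N K B) (k : Fin K) :
    (A * batchMean D k).trace.re = (1 / (B : ℝ)) * ∑ b, (A * snapshot (D (k, b))).trace.re := by
  rw [batchMean, Matrix.mul_smul, Matrix.trace_smul, Matrix.mul_sum, Matrix.trace_sum, smul_eq_mul]
  have : (1 / (B : ℂ)) = ((1 / (B : ℝ) : ℝ) : ℂ) := by push_cast; rfl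
  rw [this, Complex.re_ofReal_mul, Complex.re_sum]

/-- The tail bound for the classical shadow procedure. -/
theorem shadowLaw_not_accurate_le {N : ℕ} {A : Op N} {l : ℕ} (hA : IsScaledPauli A l)
    {ψ : Bits N → ℂ} (hψ : expect 1 ψ = 1) {K B : ℕ} (hK : 0 < K) (hB : 0 < B) {ε : ℝ}
    (hε : 0 < ε) (hlB : 11 * 3 ^ l ≤ B * ε ^ 2) :
    (shadowLaw K B ψ).real {D | ¬ Accurate ε D ψ A} ≤ Real.exp (-(K / 2)) := by
  have := isProbabilityMeasure_recordLaw hψ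
  have h := measureReal_median_deviation_le (recordLaw ψ)
    (X := fun ω => (A * snapshot ω).trace.re) .of_discrete hK hε hB hlB
    (integral_sq_trace_mul_snapshot_le hA hψ)
  rw [integral_trace_mul_snapshot hA] at h
  simpa only [shadowLaw, Accurate, shadowEstimate, trace_mul_batchMean_re, not_le] using h

/-! ### Pauli gates and the parameter-shift rule -/

/-- Euler's formula for an involution `G`. -/
theorem exp_smul_of_mul_self_eq_one {n : Type*} [Fintype n] [DecidableEq n] {G : Matrix n n ℂ}
    (hG : G * G = 1) (z : ℂ) :
    NormedSpace.exp (z • G) = Complex.cosh z • (1 : Matrix n n ℂ) + Complex.sinh z • G := by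
  -- `G` acts as `± 1` on the ranges of `1 ± G`
  have hpow : ∀ k : ℕ, (z • G) ^ k =
      z ^ k • ((1 / 2 : ℂ) • (1 + G)) + (-z) ^ k • ((1 / 2 : ℂ) • (1 - G)) := by
    intro k
    induction k with
    | zero => simp only [pow_zero]; module
    | succ k ih =>
      rw [pow_succ, ih]
      simp only [add_mul, sub_mul, smul_mul_assoc, mul_smul_comm, one_mul, hG, pow_succ]
      module
  have hsum := ((NormedSpace.expSeries_div_hasSum_exp z).smul_const
    ((1 / 2 : ℂ) • (1 + G))).add
    ((NormedSpace.expSeries_div_hasSum_exp (-z)).smul_const ((1 / 2 : ℂ) • (1 - G)))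
  have hterm : (fun k : ℕ => ((k.factorial : ℂ)⁻¹) • (z • G) ^ k) = fun k : ℕ =>
      (z ^ k / (k.factorial : ℂ)) • ((1 / 2 : ℂ) • (1 + G))
        + ((-z) ^ k / (k.factorial : ℂ)) • ((1 / 2 : ℂ) • (1 - G)) := by
    funext k
    rw [hpow, smul_add]
    simp only [smul_smul, div_eq_inv_mul, mul_assoc]
  rw [← hterm] at hsum
  rw [NormedSpace.exp_eq_tsum ℂ]
  refine (HasSum.tsum_eq hsum).trans ?_
  rw [← Complex.exp_eq_exp_ℂ, Complex.cosh, Complex.sinh]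
  module

/-- The gate `exp (-i κ t s)` is `cos (κ t) - i sin (κ t) s`. -/
theorem exp_pauliString {N : ℕ} (s : PauliString N) (κ t : ℝ) :
    NormedSpace.exp ((-(Complex.I * (κ : ℂ) * (t : ℂ))) • s.op) =
      (Real.cos (κ * t) : ℂ) • (1 : Op N) - (Complex.I * (Real.sin (κ * t) : ℂ)) • s.op := by
  rw [exp_smul_of_mul_self_eq_one s.op_mul_self]
  have h : -(Complex.I * (κ : ℂ) * (t : ℂ)) = -(((κ * t : ℝ) : ℂ) * Complex.I) := by
    push_cast; ring
  rw [h, Complex.cosh_neg, Complex.sinh_neg, Complex.cosh_mul_I, Complex.sinh_mul_I,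
    ← Complex.ofReal_cos, ← Complex.ofReal_sin]
  module

/-- Conjugating an operator by a Pauli gate of angle `x` gives a trigonometric polynomial in
`2 x`. -/
theorem gate_conj {N : ℕ} (s : PauliString N) (A : Op N) (x : ℝ) :
    ((Real.cos x : ℂ) • (1 : Op N) - (Complex.I * (Real.sin x : ℂ)) • s.op).conjTranspose * A *
        ((Real.cos x : ℂ) • (1 : Op N) - (Complex.I * (Real.sin x : ℂ)) • s.op) =
      (1 / 2 : ℂ) • (A + s.op * A * s.op)
        + (Real.cos (2 * x) : ℂ) • ((1 / 2 : ℂ) • (A - s.op * A * s.op))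
        + (Real.sin (2 * x) : ℂ) • ((Complex.I / 2) • (s.op * A - A * s.op)) := by
  have h1 : (Real.cos (2 * x) : ℂ) = (Real.cos x : ℂ) ^ 2 - (Real.sin x : ℂ) ^ 2 := by
    rw [Real.cos_two_mul']; push_cast; rfl
  have h2 : (Real.sin (2 * x) : ℂ) = 2 * (Real.sin x : ℂ) * (Real.cos x : ℂ) := by
    rw [Real.sin_two_mul]; push_cast; rfl
  have h3 : Complex.cos (x : ℂ) ^ 2 + Complex.sin (x : ℂ) ^ 2 = 1 := by
    rw [add_comm, Complex.sin_sq_add_cos_sq]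
  have hI : Complex.I ^ 2 = -1 := Complex.I_sq
  simp only [Matrix.conjTranspose_sub, Matrix.conjTranspose_smul, Matrix.conjTranspose_one,
    PauliString.op_conjTranspose, star_mul', Complex.star_def, Complex.conj_ofReal, Complex.conj_I,
    sub_mul, mul_sub, smul_mul_assoc, mul_smul_comm, one_mul, mul_one, smul_smul, h1, h2,
    smul_sub, smul_add]
  match_scalars <;> first
    | ring1
    | linear_combination (1 / 2 : ℂ) * h3
    | linear_combination (1 / 2 : ℂ) * h3 - Complex.sin (x : ℂ) ^ 2 * hI

theorem gate_mem_unitaryGroup {N : ℕ} (s : PauliString N) (x : ℝ) :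
    (Real.cos x : ℂ) • (1 : Op N) - (Complex.I * (Real.sin x : ℂ)) • s.op
      ∈ Matrix.unitaryGroup (Bits N) ℂ := by
  rw [Matrix.mem_unitaryGroup_iff', Matrix.star_eq_conjTranspose]
  have h := gate_conj s 1 x
  rw [mul_one] at h
  rw [h, mul_one, s.op_mul_self, one_mul]
  module

/-- Replacing one factor of an ordered product changes it only in the middle: the factors to the left
and to the right of it do not depend on the replacement. -/
theorem exists_prod_reverse_ofFn_update {M : Type*} [Monoid M] (S : Submonoid M) {ν : ℕ}
    (F : Fin ν → M) (hF : ∀ l, F l ∈ S) (n : Fin ν) :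
    ∃ V ∈ S, ∃ W ∈ S, ∀ g, ((List.ofFn (Function.update F n g)).reverse).prod = V * g * W := by
  induction ν with
  | zero => exact n.elim0
  | succ ν ih =>
    refine Fin.cases ?_ (fun m => ?_) n
    · refine ⟨((List.ofFn fun l => F l.succ).reverse).prod, ?_, 1, S.one_mem, fun g => ?_⟩
      · refine S.list_prod_mem fun x hx => ?_
        obtain ⟨l, rfl⟩ := (List.mem_ofFn' _ _).1 (List.mem_reverse.1 hx)
        exact hF _
      · simp [List.ofFn_succ]
    · obtain ⟨V, hV, W, hW, h⟩ := ih (fun l => F l.succ) (fun l => hF _) m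
      refine ⟨V, hV, W * F 0, S.mul_mem hW (hF 0), fun g => ?_⟩
      have hu : (fun l : Fin ν => Function.update F m.succ g l.succ) =
          Function.update (fun l => F l.succ) m g := by
        funext l
        by_cases hl : l = m
        · subst hl; simp
        · rw [Function.update_of_ne hl, Function.update_of_ne (by simpa using hl)]
      rw [List.ofFn_succ, hu, List.reverse_cons, List.prod_append, h,
        Function.update_of_ne (Fin.succ_ne_zero m).symm]
      simp [mul_assoc]

namespace PauliCircuit

variable {N ν : ℕ}

theorem layer_mem_unitaryGroup (C : PauliCircuit N ν) (κ : ℝ) (l : Fin ν) (t : ℝ) :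
    C.layer κ l t ∈ Matrix.unitaryGroup (Bits N) ℂ := by
  rw [layer, exp_pauliString]
  exact mul_mem (gate_mem_unitaryGroup _ _) (C.fixed l).2

/-- A single layer of the circuit can be isolated. -/
theorem exists_unitary_update (C : PauliCircuit N ν) (κ : ℝ) (θ : Fin ν → ℝ) (n : Fin ν) :
    ∃ V ∈ Matrix.unitaryGroup (Bits N) ℂ, ∃ W ∈ Matrix.unitaryGroup (Bits N) ℂ, ∀ t,
      C.unitary κ (Function.update θ n t) = V * C.layer κ n t * W := by
  obtain ⟨V, hV, W, hW, h⟩ := exists_prod_reverse_ofFn_update (Matrix.unitaryGroup (Bits N) ℂ)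
    (fun l => C.layer κ l (θ l)) (fun l => C.layer_mem_unitaryGroup κ l _) n
  refine ⟨C.last * V, mul_mem C.last.2 hV, W, hW, fun t => ?_⟩
  have hu : (fun l => C.layer κ l (Function.update θ n t l)) =
      Function.update (fun l => C.layer κ l (θ l)) n (C.layer κ n t) := by
    funext l
    exact Function.apply_update (fun l => C.layer κ l) θ n t l
  rw [unitary, hu, h]
  simp only [mul_assoc]

theorem unitary_mem_unitaryGroup (C : PauliCircuit N ν) (κ : ℝ) (θ : Fin ν → ℝ) :
    C.unitary κ θ ∈ Matrix.unitaryGroup (Bits N) ℂ := by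
  refine mul_mem C.last.2 (Submonoid.list_prod_mem _ fun x hx => ?_)
  obtain ⟨l, rfl⟩ := (List.mem_ofFn' _ _).1 (List.mem_reverse.1 hx)
  exact C.layer_mem_unitaryGroup κ l _

theorem expect_one_state (C : PauliCircuit N ν) (κ : ℝ) (θ : Fin ν → ℝ) :
    expect 1 (C.state κ θ) = 1 := by
  have h := Matrix.mem_unitaryGroup_iff'.1 (C.unitary_mem_unitaryGroup κ θ)
  rw [Matrix.star_eq_conjTranspose] at h
  rw [state, expect_mulVec, mul_one, h, expect, Matrix.one_mulVec]
  simp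

/-- The (real part of the) expected value of `A` as a function of the `n`-th parameter. -/
noncomputable def expectAlong (C : PauliCircuit N ν) (κ : ℝ) (θ : Fin ν → ℝ) (n : Fin ν)
    (A : Op N) (t : ℝ) : ℝ :=
  (expect A (C.state κ (Function.update θ n t))).re

/-- Along one parameter, expected values are trigonometric polynomials of degree one in `2 κ t`. -/
theorem exists_expectAlong_eq (C : PauliCircuit N ν) (κ : ℝ) (θ : Fin ν → ℝ) (n : Fin ν)
    (A : Op N) : ∃ a b c : ℝ, ∀ t, C.expectAlong κ θ n A t =
      a + b * Real.cos (2 * κ * t) + c * Real.sin (2 * κ * t) := by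
  obtain ⟨V, -, W, -, h⟩ := C.exists_unitary_update κ θ n
  set A' : Op N := V.conjTranspose * A * V
  set s := C.gen n
  set χ : Bits N → ℂ := ((C.fixed n : Op N) * W).mulVec (Pi.single 0 1)
  refine ⟨(expect ((1 / 2 : ℂ) • (A' + s.op * A' * s.op)) χ).re,
    (expect ((1 / 2 : ℂ) • (A' - s.op * A' * s.op)) χ).re,
    (expect ((Complex.I / 2) • (s.op * A' - A' * s.op)) χ).re, fun t => ?_⟩
  have hg := gate_conj s A' (κ * t)
  have hst : C.state κ (Function.update θ n t) = V.mulVec (Matrix.mulVec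
      ((Real.cos (κ * t) : ℂ) • (1 : Op N) - (Complex.I * (Real.sin (κ * t) : ℂ)) • s.op) χ) := by
    rw [state, h, layer, exp_pauliString, Matrix.mulVec_mulVec, Matrix.mulVec_mulVec]
    simp only [mul_assoc, s]
  rw [expectAlong, hst, expect_mulVec, expect_mulVec, hg, expect_add, expect_add,
    expect_smul (Real.cos _ : ℂ), expect_smul (Real.sin _ : ℂ), Complex.add_re, Complex.add_re,
    Complex.re_ofReal_mul, Complex.re_ofReal_mul]
  ring_nf

end PauliCircuit

/-- The parameter-shift rule for trigonometric polynomials with frequencies `0` and `2 κ`. -/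
theorem hasDerivAt_trig {f : ℝ → ℝ} {κ a b c : ℝ} (hκ : 0 < κ)
    (hf : ∀ t, f t = a + b * Real.cos (2 * κ * t) + c * Real.sin (2 * κ * t)) (t : ℝ) :
    HasDerivAt f (κ * (f (t + 1 * (Real.pi / (4 * κ))) - f (t + -1 * (Real.pi / (4 * κ))))) t := by
  have hp : 2 * κ * (t + 1 * (Real.pi / (4 * κ))) = 2 * κ * t + Real.pi / 2 := by
    field_simp; ring
  have hm : 2 * κ * (t + -1 * (Real.pi / (4 * κ))) = 2 * κ * t - Real.pi / 2 := by
    field_simp; ring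
  have hlin : HasDerivAt (fun t : ℝ => 2 * κ * t) (2 * κ) t := by
    simpa using (hasDerivAt_id t).const_mul (2 * κ)
  have hd := ((hlin.cos.const_mul b).const_add a).add (hlin.sin.const_mul c)
  rw [hf, hf, hp, hm, Real.cos_add_pi_div_two, Real.sin_add_pi_div_two, Real.cos_sub_pi_div_two,
    Real.sin_sub_pi_div_two]
  refine (hd.congr_of_eventuallyEq (.of_forall fun x => ?_)).congr_deriv (by ring)
  simp only [Pi.add_apply]
  rw [hf]

/-- The coefficients of a trigonometric polynomial `f = a + b cos + c sin` with values in `[-1, 1]`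
satisfy `|a| + √(b² + c²) ≤ 1`, so that `f` and its derivative cannot both be extremal at the same
point: with the derivative in units of `2 κ`, the sum of their absolute values is at most `√2`,
here relaxed to `3 / 2`. -/
theorem abs_add_abs_shift_le {f : ℝ → ℝ} {κ a b c : ℝ} (hκ : 0 < κ)
    (hf : ∀ t, f t = a + b * Real.cos (2 * κ * t) + c * Real.sin (2 * κ * t))
    (hf1 : ∀ t, |f t| ≤ 1) (t : ℝ) :
    2 * |f t| + |f (t + 1 * (Real.pi / (4 * κ))) - f (t + -1 * (Real.pi / (4 * κ)))| ≤ 3 := by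
  have hp : 2 * κ * (t + 1 * (Real.pi / (4 * κ))) = 2 * κ * t + Real.pi / 2 := by
    field_simp; ring
  have hm : 2 * κ * (t + -1 * (Real.pi / (4 * κ))) = 2 * κ * t - Real.pi / 2 := by
    field_simp; ring
  have hft := hf t
  have hdiff : f (t + 1 * (Real.pi / (4 * κ))) - f (t + -1 * (Real.pi / (4 * κ))) =
      2 * (c * Real.cos (2 * κ * t) - b * Real.sin (2 * κ * t)) := by
    rw [hf, hf, hp, hm, Real.cos_add_pi_div_two, Real.sin_add_pi_div_two, Real.cos_sub_pi_div_two,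
      Real.sin_sub_pi_div_two]
    ring
  rw [hdiff, abs_mul, abs_two, hft]
  set z : ℂ := ⟨b, c⟩ with hz
  have hb : ‖z‖ * Real.cos z.arg = b := Complex.norm_mul_cos_arg z
  have hc : ‖z‖ * Real.sin z.arg = c := Complex.norm_mul_sin_arg z
  have hR0 : 0 ≤ ‖z‖ := norm_nonneg z
  set R := ‖z‖
  set φ := z.arg
  have hmax : f (φ / (2 * κ)) = a + R := by
    have : 2 * κ * (φ / (2 * κ)) = φ := by field_simp
    rw [hf, this, ← hb, ← hc]
    linear_combination R * Real.cos_sq_add_sin_sq φ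
  have hmin : f ((φ + Real.pi) / (2 * κ)) = a - R := by
    have : 2 * κ * ((φ + Real.pi) / (2 * κ)) = φ + Real.pi := by field_simp
    rw [hf, this, Real.cos_add_pi, Real.sin_add_pi, ← hb, ← hc]
    linear_combination -R * Real.cos_sq_add_sin_sq φ
  have h₁ := abs_le.1 (hmax ▸ hf1 (φ / (2 * κ)))
  have h₂ := abs_le.1 (hmin ▸ hf1 ((φ + Real.pi) / (2 * κ)))
  -- `x` and `y` are the oscillating part of `f t` and the normalised derivative: the vector
  -- `(b, c)`, rotated
  set x := b * Real.cos (2 * κ * t) + c * Real.sin (2 * κ * t) with hx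
  set y := c * Real.cos (2 * κ * t) - b * Real.sin (2 * κ * t) with hy
  have hxy : x ^ 2 + y ^ 2 = R ^ 2 := by
    rw [hx, hy, ← hb, ← hc]
    linear_combination R ^ 2 * (Real.cos_sq_add_sin_sq (2 * κ * t) *
      (Real.cos φ ^ 2 + Real.sin φ ^ 2) + Real.cos_sq_add_sin_sq φ)
  have habs : |x| + |y| ≤ 3 / 2 * R := by
    refine abs_le_of_sq_le_sq' ?_ (by positivity) |>.2
    nlinarith [sq_nonneg (|x| - |y|), sq_abs x, sq_abs y, sq_nonneg R]
  have ha : |a| + R ≤ 1 := by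
    rcases abs_cases a with ⟨h, -⟩ | ⟨h, -⟩ <;> rw [h] <;> linarith
  have htri : |a + b * Real.cos (2 * κ * t) + c * Real.sin (2 * κ * t)| ≤ |a| + |x| := by
    rw [add_assoc]; exact abs_add_le a x
  linarith [abs_nonneg a]

/-! ### Errors of the estimates at accurate data -/

namespace PauliCircuit

variable {N ν : ℕ}

/-- The value of `∂ ⟨A⟩ / ∂ θ_n` according to the parameter-shift rule. -/
noncomputable def shiftDeriv (C : PauliCircuit N ν) (κ : ℝ) (θ : Fin ν → ℝ) (n : Fin ν)
    (A : Op N) : ℝ :=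
  κ * ((expect A (C.state κ (shiftedParams κ θ (n, true)))).re
    - (expect A (C.state κ (shiftedParams κ θ (n, false)))).re)

theorem shiftDeriv_eq (C : PauliCircuit N ν) (κ : ℝ) (θ : Fin ν → ℝ) (n : Fin ν) (A : Op N) :
    C.shiftDeriv κ θ n A = κ * (C.expectAlong κ θ n A (θ n + 1 * (Real.pi / (4 * κ)))
      - C.expectAlong κ θ n A (θ n + -1 * (Real.pi / (4 * κ)))) := by
  simp [shiftDeriv, expectAlong, shiftedParams]

theorem hasDerivAt_expectAlong (C : PauliCircuit N ν) {κ : ℝ} (hκ : 0 < κ) (θ : Fin ν → ℝ)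
    (n : Fin ν) (A : Op N) :
    HasDerivAt (C.expectAlong κ θ n A) (C.shiftDeriv κ θ n A) (θ n) := by
  obtain ⟨a, b, c, h⟩ := C.exists_expectAlong_eq κ θ n A
  rw [shiftDeriv_eq]
  exact hasDerivAt_trig hκ h (θ n)

theorem expectAlong_self (C : PauliCircuit N ν) (κ : ℝ) (θ : Fin ν → ℝ) (n : Fin ν) (A : Op N) :
    C.expectAlong κ θ n A (θ n) = (expect A (C.state κ θ)).re := by
  rw [expectAlong, Function.update_eq_self]

/-- The expected value of a Pauli string and its derivative cannot both be extremal. -/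
theorem two_mul_abs_expect_add_abs_shiftDeriv_le (C : PauliCircuit N ν) {κ : ℝ} (hκ : 0 < κ)
    (θ : Fin ν → ℝ) (n : Fin ν) (s : PauliString N) :
    κ * (2 * |(expect s.op (C.state κ θ)).re|) + |C.shiftDeriv κ θ n s.op| ≤ 3 * κ := by
  obtain ⟨a, b, c, h⟩ := C.exists_expectAlong_eq κ θ n s.op
  have := abs_add_abs_shift_le hκ h
    (fun t => abs_expect_op_le s (C.expect_one_state κ (Function.update θ n t))) (θ n)
  rw [expectAlong_self] at this
  rw [shiftDeriv_eq, abs_mul, abs_of_pos hκ, ← mul_add, mul_comm 3 κ]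
  exact mul_le_mul_of_nonneg_left this hκ.le

theorem abs_derivEstimate_sub_le (C : PauliCircuit N ν) {κ : ℝ} (hκ : 0 < κ) (θ : Fin ν → ℝ)
    (n : Fin ν) {A : Op N} {K B : ℕ} {D : Fin ν × Bool → ShadowData N K B} {ε : ℝ}
    (hD : ∀ c, Accurate ε (D c) (C.state κ (shiftedParams κ θ c)) A) :
    |derivEstimate κ D n A - C.shiftDeriv κ θ n A| ≤ 2 * κ * ε := by
  have h₁ := abs_le.1 (hD (n, true))
  have h₂ := abs_le.1 (hD (n, false))
  rw [derivEstimate, shiftDeriv, ← mul_sub, abs_mul, abs_of_pos hκ]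
  have : |shadowEstimate (D (n, true)) A - shadowEstimate (D (n, false)) A -
      ((expect A (C.state κ (shiftedParams κ θ (n, true)))).re
        - (expect A (C.state κ (shiftedParams κ θ (n, false)))).re)| ≤ 2 * ε :=
    abs_le.2 ⟨by linarith, by linarith⟩
  calc _ ≤ κ * (2 * ε) := mul_le_mul_of_nonneg_left this hκ.le
    _ = 2 * κ * ε := by ring

theorem hasDerivAt_energy (C : PauliCircuit N ν) {κ : ℝ} (hκ : 0 < κ) (θ : Fin ν → ℝ)
    {r : ℕ} (h : Fin r → ℝ) (H : Fin r → PauliString N) (n : Fin ν) :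
    HasDerivAt (fun t : ℝ => C.energy κ (hamiltonian h H) (Function.update θ n t))
      (∑ a, h a * C.shiftDeriv κ θ n (H a).op) (θ n) := by
  have hE : (fun t : ℝ => C.energy κ (hamiltonian h H) (Function.update θ n t)) =
      fun t => ∑ a, h a * C.expectAlong κ θ n (H a).op t := by
    funext t
    simp only [energy, hamiltonian, expect_sum, expect_smul, Complex.re_sum, Complex.re_ofReal_mul,
      expectAlong]
  rw [hE]
  exact HasDerivAt.fun_sum fun a _ => (C.hasDerivAt_expectAlong hκ θ n _).const_mul _

theorem abs_gradientEstimate_sub_le (C : PauliCircuit N ν) {κ : ℝ} (hκ : 0 < κ) (θ : Fin ν → ℝ)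
    {r : ℕ} (h : Fin r → ℝ) (H : Fin r → PauliString N) (n : Fin ν) {K B : ℕ}
    {D : Fin ν × Bool → ShadowData N K B} {ε : ℝ}
    (hD : ∀ c, AccurateForGradient ε H (D c) (C.state κ (shiftedParams κ θ c))) :
    |gradientEstimate κ h H D n - C.energyGrad κ (hamiltonian h H) θ n|
      ≤ 2 * κ * (∑ a, |h a|) * ε := by
  rw [energyGrad, (C.hasDerivAt_energy hκ θ h H n).deriv, gradientEstimate,
    ← Finset.sum_sub_distrib]
  calc |∑ a, (h a * derivEstimate κ D n (H a).op - h a * C.shiftDeriv κ θ n (H a).op)|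
      ≤ ∑ a, |h a| * (2 * κ * ε) := by
        refine (Finset.abs_sum_le_sum_abs _ _).trans (Finset.sum_le_sum fun a _ => ?_)
        rw [← mul_sub, abs_mul]
        exact mul_le_mul_of_nonneg_left (C.abs_derivEstimate_sub_le hκ θ n fun c => hD c a)
          (abs_nonneg _)
    _ = 2 * κ * (∑ a, |h a|) * ε := by rw [← Finset.sum_mul]; ring

/-- The parameter-shift formula for the entries of the Jacobian. -/
theorem hasDerivAt_covarFun (C : PauliCircuit N ν) {κ : ℝ} (hκ : 0 < κ) (θ : Fin ν → ℝ)
    {r p q : ℕ} (h : Fin r → ℝ) {H : Fin r → PauliString N} (hH : ∀ a, (H a).IsLocal p)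
    {O : PauliString N} (hO : O.IsLocal q) (n : Fin ν) :
    HasDerivAt (fun t : ℝ => C.covarFun κ (hamiltonian h H) O (Function.update θ n t))
      (∑ a, (h a : ℂ) * ((C.shiftDeriv κ θ n (halfAnticomm O (H a)) : ℂ)
        + Complex.I * (C.shiftDeriv κ θ n (halfComm O (H a)) : ℂ)
        - ((expect O.op (C.state κ θ)).re : ℂ) * (C.shiftDeriv κ θ n (H a).op : ℂ)
        - ((expect (H a).op (C.state κ θ)).re : ℂ) * (C.shiftDeriv κ θ n O.op : ℂ))) (θ n) := by
  have hf : (fun t : ℝ => C.covarFun κ (hamiltonian h H) O (Function.update θ n t)) =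
      fun t => ∑ a, (h a : ℂ) * ((C.expectAlong κ θ n (halfAnticomm O (H a)) t : ℂ)
        + Complex.I * (C.expectAlong κ θ n (halfComm O (H a)) t : ℂ)
        - (C.expectAlong κ θ n O.op t : ℂ) * (C.expectAlong κ θ n (H a).op t : ℂ)) := by
    funext t
    simp only [covarFun, covar, hamiltonian, Finset.mul_sum, mul_smul_comm, expect_sum, expect_smul,
      ← halfAnticomm_add_halfComm, expect_add]
    rw [← Finset.sum_sub_distrib]
    refine Finset.sum_congr rfl fun a _ => ?_
    rw [(isScaledPauli_halfAnticomm hO (hH a)).expect_eq,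
      (isScaledPauli_halfComm hO (hH a)).expect_eq, hO.isScaledPauli.expect_eq,
      (hH a).isScaledPauli.expect_eq]
    simp only [expectAlong]
    ring
  rw [hf]
  refine HasDerivAt.fun_sum fun a _ => HasDerivAt.const_mul _ ?_
  have hd := fun A => (C.hasDerivAt_expectAlong hκ θ n A).ofReal_comp
  refine (((hd (halfAnticomm O (H a))).add ((hd (halfComm O (H a))).const_mul Complex.I)).sub
    ((hd O.op).mul (hd (H a).op))).congr_deriv ?_
  rw [expectAlong_self, expectAlong_self]
  ring

end PauliCircuit

theorem abs_mul_sub_mul_le {x y x' y' ε η : ℝ} (hx : |x' - x| ≤ ε) (hy : |y' - y| ≤ η) :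
    |x' * y' - x * y| ≤ ε * |y| + η * |x| + ε * η := by
  have h : x' * y' - x * y = (x' - x) * y + (y' - y) * x + (x' - x) * (y' - y) := by ring
  rw [h]
  refine (abs_add_three _ _ _).trans ?_
  rw [abs_mul, abs_mul, abs_mul]
  have := (abs_nonneg (x' - x)).trans hx
  gcongr

/-- The derivatives of `⟨P_ka⟩` and `⟨Q_ka⟩` contribute an error of `2 κ ε` each, and the products
`⟨O_k⟩ ∂⟨H_a⟩` and `⟨H_a⟩ ∂⟨O_k⟩` one of `10 κ ε` together. -/
theorem PauliCircuit.norm_jacobianEstimate_sub_le {N ν : ℕ} (C : PauliCircuit N ν) {κ : ℝ}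
    (hκ : 0 < κ) (θ : Fin ν → ℝ) {r Nc p q : ℕ} (h : Fin r → ℝ) {H : Fin r → PauliString N}
    (hH : ∀ a, (H a).IsLocal p) {O : Fin Nc → PauliString N} (hO : ∀ k, (O k).IsLocal q)
    {K B : ℕ} {D : Option (Fin ν × Bool) → ShadowData N K B} {ε : ℝ} (hε : 0 < ε) (hε1 : ε ≤ 1)
    (hD : ∀ c, AccurateForJacobian ε H O (D c) (C.state κ (jacobianParams κ θ c)))
    (k : Fin Nc) (n : Fin ν) :
    ‖jacobianEstimate κ h H O D k n - C.jacobian κ (hamiltonian h H) O θ k n‖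
      ≤ 14 * κ * (∑ a, |h a|) * ε := by
  rw [jacobian, Matrix.of_apply, (C.hasDerivAt_covarFun hκ θ h hH (hO k) n).deriv,
    jacobianEstimate, Matrix.of_apply, ← Finset.sum_sub_distrib]
  have key : ∀ a, ‖((derivEstimate κ (fun c => D (some c)) n (halfAnticomm (O k) (H a)) : ℂ)
      + Complex.I * (derivEstimate κ (fun c => D (some c)) n (halfComm (O k) (H a)) : ℂ)
      - (shadowEstimate (D none) (O k).op : ℂ)
          * (derivEstimate κ (fun c => D (some c)) n (H a).op : ℂ)
      - (shadowEstimate (D none) (H a).op : ℂ)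
          * (derivEstimate κ (fun c => D (some c)) n (O k).op : ℂ))
      - ((C.shiftDeriv κ θ n (halfAnticomm (O k) (H a)) : ℂ)
        + Complex.I * (C.shiftDeriv κ θ n (halfComm (O k) (H a)) : ℂ)
        - ((expect (O k).op (C.state κ θ)).re : ℂ) * (C.shiftDeriv κ θ n (H a).op : ℂ)
        - ((expect (H a).op (C.state κ θ)).re : ℂ) * (C.shiftDeriv κ θ n (O k).op : ℂ))‖
      ≤ 14 * κ * ε := by
    intro a
    have hP := C.abs_derivEstimate_sub_le hκ θ n (D := fun c => D (some c))
      fun c => ((hD (some c)).2.2 k a).1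
    have hQ := C.abs_derivEstimate_sub_le hκ θ n (D := fun c => D (some c))
      fun c => ((hD (some c)).2.2 k a).2
    have hdH := C.abs_derivEstimate_sub_le hκ θ n (D := fun c => D (some c))
      fun c => (hD (some c)).1 a
    have hdO := C.abs_derivEstimate_sub_le hκ θ n (D := fun c => D (some c))
      fun c => (hD (some c)).2.1 k
    have h₁ := abs_mul_sub_mul_le ((hD none).2.1 k) hdH
    have h₂ := abs_mul_sub_mul_le ((hD none).1 a) hdO
    have b₁ := C.two_mul_abs_expect_add_abs_shiftDeriv_le hκ θ n (O k)
    have b₂ := C.two_mul_abs_expect_add_abs_shiftDeriv_le hκ θ n (H a)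
    simp only [jacobianParams] at h₁ h₂
    have hsplit : ∀ P Q o H' h' O' P₀ Q₀ o₀ H₀ h₀ O₀ : ℝ,
        ‖((P : ℂ) + Complex.I * Q - o * H' - h' * O')
          - ((P₀ : ℂ) + Complex.I * Q₀ - o₀ * H₀ - h₀ * O₀)‖
        ≤ |P - P₀| + |Q - Q₀| + |o * H' - o₀ * H₀| + |h' * O' - h₀ * O₀| := by
      intro P Q o H' h' O' P₀ Q₀ o₀ H₀ h₀ O₀
      have : ((P : ℂ) + Complex.I * Q - o * H' - h' * O')
          - ((P₀ : ℂ) + Complex.I * Q₀ - o₀ * H₀ - h₀ * O₀) =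
          ((P - P₀ : ℝ) : ℂ) + Complex.I * ((Q - Q₀ : ℝ) : ℂ) - ((o * H' - o₀ * H₀ : ℝ) : ℂ)
            - ((h' * O' - h₀ * O₀ : ℝ) : ℂ) := by
        push_cast; ring
      rw [this]
      refine (norm_sub_le _ _).trans (add_le_add ((norm_sub_le _ _).trans (add_le_add
        ((norm_add_le _ _).trans (add_le_add ?_ ?_)) ?_)) ?_) <;>
        simp only [norm_mul, Complex.norm_I, one_mul, Complex.norm_real, Real.norm_eq_abs, le_refl]
    refine (hsplit _ _ _ _ _ _ _ _ _ _ _ _).trans ?_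
    have e₁ := mul_le_mul_of_nonneg_left (add_le_add b₁ b₂) hε.le
    have e₂ : κ * ε * ε ≤ κ * ε := mul_le_of_le_one_right (by positivity) hε1
    linarith
  calc _ ≤ ∑ a, |h a| * (14 * κ * ε) := by
        refine (norm_sum_le _ _).trans (Finset.sum_le_sum fun a _ => ?_)
        rw [← mul_sub, norm_mul, Complex.norm_real, Real.norm_eq_abs]
        exact mul_le_mul_of_nonneg_left (key a) (abs_nonneg _)
    _ = 14 * κ * (∑ a, |h a|) * ε := by rw [← Finset.sum_mul]; ring

/-! ### Success probabilities -/

theorem isProbabilityMeasure_shadowLaw {N : ℕ} (K B : ℕ) {ψ : Bits N → ℂ}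
    (hψ : expect 1 ψ = 1) : IsProbabilityMeasure (shadowLaw K B ψ) := by
  have := isProbabilityMeasure_recordLaw hψ
  unfold shadowLaw
  infer_instance

/-- The union bound over a finite family of operators. -/
theorem le_shadowLaw_forall_accurate {N : ℕ} {ι : Type*} [Fintype ι] {A : ι → Op N} {l : ℕ}
    (hA : ∀ i, IsScaledPauli (A i) l) {ψ : Bits N → ℂ} (hψ : expect 1 ψ = 1) {K B : ℕ}
    (hK : 0 < K) (hB : 0 < B) {ε : ℝ} (hε : 0 < ε) (hlB : 11 * 3 ^ l ≤ B * ε ^ 2) :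
    1 - Fintype.card ι * Real.exp (-(K / 2)) ≤
      (shadowLaw K B ψ).real {D | ∀ i, Accurate ε D ψ (A i)} := by
  have := isProbabilityMeasure_shadowLaw K B hψ
  have hc : {D : ShadowData N K B | ∀ i, Accurate ε D ψ (A i)}ᶜ =
      ⋃ i, {D | ¬ Accurate ε D ψ (A i)} := by
    ext D; simp
  have h := probReal_compl_eq_one_sub (μ := shadowLaw K B ψ)
    (s := {D | ∀ i, Accurate ε D ψ (A i)}) .of_discrete
  have hu := measureReal_iUnion_fintype_le (μ := shadowLaw K B ψ)
    (fun i => {D | ¬ Accurate ε D ψ (A i)})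
  have hs : ∑ i, (shadowLaw K B ψ).real {D | ¬ Accurate ε D ψ (A i)} ≤
      Fintype.card ι * Real.exp (-(K / 2)) := by
    refine (Finset.sum_le_sum fun i _ =>
      shadowLaw_not_accurate_le (hA i) hψ hK hB hε hlB).trans ?_
    simp
  rw [hc] at h
  linarith

theorem measureReal_pi_eval {ι : Type*} [Fintype ι] {Ω : ι → Type*} [∀ c, MeasurableSpace (Ω c)]
    (P : ∀ c, Measure (Ω c)) [∀ c, IsProbabilityMeasure (P c)] (c : ι) {G : Set (Ω c)}
    (hG : MeasurableSet G) : (Measure.pi P).real {D | D c ∈ G} = (P c).real G :=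
  (measurePreserving_eval P c).measureReal_preimage hG.nullMeasurableSet

theorem pow_card_le_measureReal_pi {ι : Type*} [Fintype ι] {Ω : ι → Type*}
    [∀ c, MeasurableSpace (Ω c)] (P : ∀ c, Measure (Ω c)) [∀ c, IsProbabilityMeasure (P c)]
    {G : ∀ c, Set (Ω c)} {x : ℝ} (hx : 0 ≤ x) (h : ∀ c, x ≤ (P c).real (G c)) :
    x ^ Fintype.card ι ≤ (Measure.pi P).real {D | ∀ c, D c ∈ G c} := by
  have hbox : {D : ∀ c, Ω c | ∀ c, D c ∈ G c} = Set.univ.pi G := by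
    ext D; simp
  rw [hbox, measureReal_def, Measure.pi_pi, ENNReal.toReal_prod, ← Finset.card_univ,
    ← Finset.prod_const]
  exact Finset.prod_le_prod (fun _ _ => hx) fun c _ => h c

/-! ### Numbers of samples -/

/-- The numbers of batches and the batch sizes: with `A = 3 ^ l / ε ^ 2` they give a failure
probability of at most `exp (-2 L)` per Pauli string. -/
theorem exists_batches {A L : ℝ} (hA : 1 ≤ A) (hL : 2 / 3 ≤ L) :
    ∃ K B : ℕ, 0 < K ∧ 0 < B ∧ 4 * L ≤ K ∧ 11 * A ≤ B ∧ (K : ℝ) * B ≤ 68 * A * L ∧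
      60 * A * L ≤ (K : ℝ) * B := by
  have hK : 4 * L ≤ (⌈4 * L⌉₊ : ℝ) := Nat.le_ceil _
  have hK' : (⌈4 * L⌉₊ : ℝ) < 4 * L + 1 := Nat.ceil_lt_add_one (by linarith)
  set K := ⌈4 * L⌉₊
  have hK0 : (0 : ℝ) < K := by linarith
  have hAL : L ≤ A * L := le_mul_of_one_le_left (by linarith) hA
  have hx : 0 ≤ 68 * A * L / K := by positivity
  have hB : (⌊68 * A * L / K⌋₊ : ℝ) ≤ 68 * A * L / K := Nat.floor_le hx
  have hB' : 68 * A * L / K < (⌊68 * A * L / K⌋₊ : ℝ) + 1 := Nat.lt_floor_add_one _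
  set B := ⌊68 * A * L / K⌋₊
  rw [le_div_iff₀ hK0] at hB
  have hB2 : 12 * A ≤ 68 * A * L / K := by
    rw [le_div_iff₀ hK0]
    have : A * K ≤ A * (11 / 2 * L) := by gcongr; linarith
    linarith
  have hB11 : 11 * A ≤ B := by linarith
  rw [div_lt_iff₀ hK0] at hB'
  refine ⟨K, B, by exact_mod_cast hK0, ?_, hK, hB11, by linarith, by linarith⟩
  have : (0 : ℝ) < B := by linarith
  exact_mod_cast this

theorem two_thirds_le_log {x : ℝ} (hx : 2 ≤ x) : 2 / 3 ≤ Real.log x := by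
  have := Real.log_le_log (by norm_num) hx
  linarith [Real.log_two_gt_d9]

theorem exp_neg_half_le_of_log_le {K : ℕ} {x : ℝ} (hx : 0 < x) (hK : 4 * Real.log x ≤ K) :
    Real.exp (-(K / 2)) ≤ (x⁻¹) ^ 2 := by
  calc Real.exp (-(K / 2)) ≤ Real.exp ((2 : ℕ) * -Real.log x) :=
        Real.exp_le_exp.2 (by push_cast; linarith)
    _ = (x⁻¹) ^ 2 := by rw [Real.exp_nat_mul, Real.exp_neg, Real.exp_log hx]

/-- The logarithms satisfy `log (6 r Nc / δ) = x + y ≤ x (1 + y / log 2)`, where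
`x = log (2 r / δ) ≥ log 2` and `y = log (3 Nc)`. -/
theorem log_le_logb_mul_log {r Nc : ℕ} (hr : 1 ≤ r) (hNc : 1 ≤ Nc) {δ : ℝ} (hδ : 0 < δ)
    (hδ1 : δ ≤ 1) :
    Real.log (6 * r * Nc / δ) ≤ Real.logb 2 (6 * Nc) * Real.log (2 * r / δ) := by
  have hr' : (1 : ℝ) ≤ r := by exact_mod_cast hr
  have hNc' : (1 : ℝ) ≤ Nc := by exact_mod_cast hNc
  have hx2 : (2 : ℝ) ≤ 2 * r / δ := by
    rw [le_div_iff₀ hδ]; nlinarith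
  have hl2 : 0 < Real.log 2 := Real.log_pos (by norm_num)
  have h₁ : Real.log (6 * r * Nc / δ) = Real.log (2 * r / δ) + Real.log (3 * Nc) := by
    rw [← Real.log_mul (by positivity) (by positivity)]
    congr 1; ring
  have h₂ : Real.logb 2 (6 * Nc) = 1 + Real.log (3 * Nc) / Real.log 2 := by
    rw [Real.logb, show (6 : ℝ) * Nc = 2 * (3 * Nc) by ring,
      Real.log_mul (by norm_num) (by positivity)]
    field_simp
  have hx := Real.log_le_log (by norm_num) hx2
  have hy : 0 ≤ Real.log (3 * Nc) := Real.log_nonneg (by linarith)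
  rw [h₁, h₂, add_mul, one_mul, div_mul_eq_mul_div]
  gcongr
  rw [le_div_iff₀ hl2]
  gcongr

theorem jacobianCost_le {p q r Nc ν : ℕ} (hr : 1 ≤ r) (hNc : 1 ≤ Nc) (hν : 1 ≤ ν) {ε δ : ℝ}
    (hδ : 0 < δ) (hδ1 : δ ≤ 1) :
    jacobianCost p q r Nc ν ε δ ≤
      3 / 2 * 3 ^ q * Real.logb 2 (6 * Nc) * gradientCost p r ν ε δ := by
  have hν' : (1 : ℝ) ≤ ν := by exact_mod_cast hν
  have hNc' : (1 : ℝ) ≤ Nc := by exact_mod_cast hNc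
  have hr' : (1 : ℝ) ≤ r := by exact_mod_cast hr
  have hlog := log_le_logb_mul_log hr hNc hδ hδ1
  have hlog0 : 0 ≤ Real.log (6 * r * Nc / δ) := by
    refine Real.log_nonneg ((one_le_div hδ).2 ?_)
    have : (1 : ℝ) ≤ r * Nc := one_le_mul_of_one_le_of_one_le hr' hNc'
    linarith
  calc jacobianCost p q r Nc ν ε δ
      ≤ (3 / 2 * (2 * ν)) * 3 ^ (p + q) * (68 / ε ^ 2)
          * (Real.logb 2 (6 * Nc) * Real.log (2 * r / δ)) := by
        unfold jacobianCost
        gcongr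
        linarith
    _ = _ := by rw [gradientCost, pow_add]; ring

/-! ### Accuracy at all configurations -/

/-- One application of the procedure with failure probability `exp (-K / 2)` per Pauli string
gives all the `r + Nc + 2 r Nc ≤ 4 r Nc` expected values needed for the Jacobian. -/
theorem le_shadowLaw_accurateForJacobian {N r Nc p q : ℕ} (hr : 1 ≤ r) (hNc : 1 ≤ Nc)
    {H : Fin r → PauliString N} (hH : ∀ a, (H a).IsLocal p) {O : Fin Nc → PauliString N}
    (hO : ∀ k, (O k).IsLocal q) {ψ : Bits N → ℂ} (hψ : expect 1 ψ = 1) {K B : ℕ}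
    (hK : 0 < K) (hB : 0 < B) {ε : ℝ} (hε : 0 < ε) (hlB : 11 * 3 ^ (p + q) ≤ B * ε ^ 2) :
    1 - 4 * r * Nc * Real.exp (-(K / 2)) ≤
      (shadowLaw K B ψ).real {D | AccurateForJacobian ε H O D ψ} := by
  have := isProbabilityMeasure_shadowLaw K B hψ
  let A : (Fin r ⊕ Fin Nc) ⊕ ((Fin Nc × Fin r) ⊕ (Fin Nc × Fin r)) → Op N :=
    Sum.elim (Sum.elim (fun a => (H a).op) (fun k => (O k).op))
      (Sum.elim (fun i => halfAnticomm (O i.1) (H i.2)) (fun i => halfComm (O i.1) (H i.2)))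
  have hA : ∀ i, IsScaledPauli (A i) (p + q) := by
    rintro ((a | k) | (i | i))
    · exact (hH a).isScaledPauli.mono (Nat.le_add_right _ _)
    · exact (hO k).isScaledPauli.mono (Nat.le_add_left _ _)
    · exact (isScaledPauli_halfAnticomm (hO i.1) (hH i.2)).mono (Nat.add_comm _ _).le
    · exact (isScaledPauli_halfComm (hO i.1) (hH i.2)).mono (Nat.add_comm _ _).le
  have hcard : (Fintype.card ((Fin r ⊕ Fin Nc) ⊕ ((Fin Nc × Fin r) ⊕ (Fin Nc × Fin r))) : ℝ)
      ≤ 4 * r * Nc := by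
    simp only [Fintype.card_sum, Fintype.card_prod, Fintype.card_fin]
    push_cast
    have hr' : (1 : ℝ) ≤ r := by exact_mod_cast hr
    have hNc' : (1 : ℝ) ≤ Nc := by exact_mod_cast hNc
    nlinarith
  calc 1 - 4 * r * Nc * Real.exp (-(K / 2))
      ≤ 1 - Fintype.card ((Fin r ⊕ Fin Nc) ⊕ ((Fin Nc × Fin r) ⊕ (Fin Nc × Fin r)))
          * Real.exp (-(K / 2)) := by
        gcongr
    _ ≤ (shadowLaw K B ψ).real {D | ∀ i, Accurate ε D ψ (A i)} :=
        le_shadowLaw_forall_accurate hA hψ hK hB hε hlB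
    _ ≤ _ := by
        refine measureReal_mono (fun D hD => ?_) (measure_ne_top _ _)
        exact ⟨fun a => hD (.inl (.inl a)), fun k => hD (.inl (.inr k)),
          fun k a => ⟨hD (.inr (.inl (k, a))), hD (.inr (.inr (k, a)))⟩⟩

theorem le_gradientLaw_coord {N ν r : ℕ} (C : PauliCircuit N ν) (κ : ℝ) (θ : Fin ν → ℝ)
    (H : Fin r → PauliString N) {K B : ℕ} {ε x : ℝ}
    (h : ∀ ψ : Bits N → ℂ, expect 1 ψ = 1 →
      x ≤ (shadowLaw K B ψ).real {D | AccurateForGradient ε H D ψ}) (c : Fin ν × Bool) :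
    x ≤ (gradientLaw K B C κ θ).real
      {D | AccurateForGradient ε H (D c) (C.state κ (shiftedParams κ θ c))} := by
  have := fun c => isProbabilityMeasure_shadowLaw K B
    (C.expect_one_state κ (shiftedParams κ θ c))
  refine (h _ (C.expect_one_state κ (shiftedParams κ θ c))).trans_eq ?_
  exact (measureReal_pi_eval (fun c => shadowLaw K B (C.state κ (shiftedParams κ θ c))) c
    (.of_discrete (s := {D | AccurateForGradient ε H D (C.state κ (shiftedParams κ θ c))}))).symm

theorem pow_le_gradientLaw {N ν r : ℕ} (C : PauliCircuit N ν) {κ : ℝ} (hκ : 0 < κ)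
    (θ : Fin ν → ℝ) (g : Fin r → ℝ) (H : Fin r → PauliString N) {K B : ℕ} {ε x : ℝ} (hx : 0 ≤ x)
    (h : ∀ ψ : Bits N → ℂ, expect 1 ψ = 1 →
      x ≤ (shadowLaw K B ψ).real {D | AccurateForGradient ε H D ψ}) :
    x ^ (2 * ν) ≤ (gradientLaw K B C κ θ).real
      {D | (∀ c, AccurateForGradient ε H (D c) (C.state κ (shiftedParams κ θ c))) ∧
        ∀ n, |gradientEstimate κ g H D n - C.energyGrad κ (hamiltonian g H) θ n|
          ≤ 2 * κ * (∑ a, |g a|) * ε} := by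
  have := fun c => isProbabilityMeasure_shadowLaw K B
    (C.expect_one_state κ (shiftedParams κ θ c))
  have hp := pow_card_le_measureReal_pi
    (fun c => shadowLaw K B (C.state κ (shiftedParams κ θ c)))
    (G := fun c => {D | AccurateForGradient ε H D (C.state κ (shiftedParams κ θ c))}) hx
    fun c => h _ (C.expect_one_state κ (shiftedParams κ θ c))
  have hcard : Fintype.card (Fin ν × Bool) = 2 * ν := by simp [mul_comm]
  rw [hcard] at hp
  refine hp.trans (measureReal_mono (fun D hD => ⟨hD, fun n => ?_⟩)
    (measure_ne_top (Measure.pi _) _))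
  exact C.abs_gradientEstimate_sub_le hκ θ g H n hD

theorem le_jacobianLaw_coord {N ν r Nc : ℕ} (C : PauliCircuit N ν) (κ : ℝ)
    (θ : Fin ν → ℝ) (H : Fin r → PauliString N) (O : Fin Nc → PauliString N) {K B : ℕ} {ε x : ℝ}
    (h : ∀ ψ : Bits N → ℂ, expect 1 ψ = 1 →
      x ≤ (shadowLaw K B ψ).real {D | AccurateForJacobian ε H O D ψ})
    (c : Option (Fin ν × Bool)) :
    x ≤ (jacobianLaw K B C κ θ).real
      {D | AccurateForJacobian ε H O (D c) (C.state κ (jacobianParams κ θ c))} := by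
  have := fun c => isProbabilityMeasure_shadowLaw K B
    (C.expect_one_state κ (jacobianParams κ θ c))
  refine (h _ (C.expect_one_state κ (jacobianParams κ θ c))).trans_eq ?_
  exact (measureReal_pi_eval (fun c => shadowLaw K B (C.state κ (jacobianParams κ θ c))) c
    (.of_discrete
      (s := {D | AccurateForJacobian ε H O D (C.state κ (jacobianParams κ θ c))}))).symm

theorem pow_le_jacobianLaw {N ν r Nc p q : ℕ} (C : PauliCircuit N ν) {κ : ℝ} (hκ : 0 < κ)
    (θ : Fin ν → ℝ) (g : Fin r → ℝ) {H : Fin r → PauliString N} (hH : ∀ a, (H a).IsLocal p)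
    {O : Fin Nc → PauliString N} (hO : ∀ k, (O k).IsLocal q) {K B : ℕ} {ε x : ℝ}
    (hε : 0 < ε) (hε1 : ε ≤ 1) (hx : 0 ≤ x)
    (h : ∀ ψ : Bits N → ℂ, expect 1 ψ = 1 →
      x ≤ (shadowLaw K B ψ).real {D | AccurateForJacobian ε H O D ψ}) :
    x ^ (2 * ν + 1) ≤ (jacobianLaw K B C κ θ).real
      {D | (∀ c, AccurateForJacobian ε H O (D c) (C.state κ (jacobianParams κ θ c))) ∧
        ∀ k n, ‖jacobianEstimate κ g H O D k n - C.jacobian κ (hamiltonian g H) O θ k n‖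
          ≤ 14 * κ * (∑ a, |g a|) * ε} := by
  have := fun c => isProbabilityMeasure_shadowLaw K B
    (C.expect_one_state κ (jacobianParams κ θ c))
  have hp := pow_card_le_measureReal_pi
    (fun c => shadowLaw K B (C.state κ (jacobianParams κ θ c)))
    (G := fun c => {D | AccurateForJacobian ε H O D (C.state κ (jacobianParams κ θ c))}) hx
    fun c => h _ (C.expect_one_state κ (jacobianParams κ θ c))
  have hcard : Fintype.card (Option (Fin ν × Bool)) = 2 * ν + 1 := by simp [mul_comm]
  rw [hcard] at hp
  refine hp.trans (measureReal_mono (fun D hD => ⟨hD, fun k n => ?_⟩)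
    (measure_ne_top (Measure.pi _) _))
  exact C.norm_jacobianEstimate_sub_le hκ θ g hH hO hε hε1 hD k n

theorem mainTheorem3 (p q r Nc ν : ℕ) (hr : 1 ≤ r) (hNc : 1 ≤ Nc)
    (ε δ : ℝ) (hε : 0 < ε) (hε1 : ε ≤ 1) (hδ : 0 < δ) (hδ1 : δ ≤ 1) :
    -- numbers of batches and batch sizes, for the Jacobian and for the gradient
    ∃ K B K' B' : ℕ,
      -- the total numbers of samples
      (((2 * ν + 1) * (K * B) : ℕ) : ℝ) ≤ jacobianCost p q r Nc ν ε δ ∧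
      (((2 * ν) * (K' * B') : ℕ) : ℝ) ≤ gradientCost p r ν ε δ ∧
      -- the Jacobian is only logarithmically more expensive, up to the factor `3 ^ q`
      (1 ≤ ν → jacobianCost p q r Nc ν ε δ ≤
        3 / 2 * 3 ^ q * Real.logb 2 (6 * Nc) * gradientCost p r ν ε δ) ∧
      (1 ≤ ν → (((2 * ν + 1) * (K * B) : ℕ) : ℝ) ≤
        4 * 3 ^ q * Real.logb 2 (6 * Nc) * (((2 * ν) * (K' * B') : ℕ) : ℝ)) ∧
      ∀ (N : ℕ) (C : PauliCircuit N ν) (κ : ℝ) (_ : 0 < κ) (θ : Fin ν → ℝ)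
        (h : Fin r → ℝ) (H : Fin r → PauliString N) (_ : ∀ a, (H a).IsLocal p),
        -- the energy gradient
        ((∀ n, DifferentiableAt ℝ
            (fun t : ℝ => C.energy κ (hamiltonian h H) (Function.update θ n t)) (θ n)) ∧
          (∀ c, 1 - δ ≤ (gradientLaw K' B' C κ θ).real
            {D | AccurateForGradient ε H (D c) (C.state κ (shiftedParams κ θ c))}) ∧
          (1 - δ) ^ (2 * ν) ≤ (gradientLaw K' B' C κ θ).real
            {D | (∀ c, AccurateForGradient ε H (D c) (C.state κ (shiftedParams κ θ c))) ∧
              ∀ n, |gradientEstimate κ h H D n - C.energyGrad κ (hamiltonian h H) θ n|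
                ≤ 2 * κ * (∑ a, |h a|) * ε}) ∧
        -- the Jacobian
        ∀ (O : Fin Nc → PauliString N) (_ : ∀ k, (O k).IsLocal q),
          (∀ k n, DifferentiableAt ℝ
            (fun t : ℝ => C.covarFun κ (hamiltonian h H) (O k) (Function.update θ n t)) (θ n)) ∧
          (∀ c, 1 - δ ≤ (jacobianLaw K B C κ θ).real
            {D | AccurateForJacobian ε H O (D c) (C.state κ (jacobianParams κ θ c))}) ∧
          (1 - δ) ^ (2 * ν + 1) ≤ (jacobianLaw K B C κ θ).real
            {D | (∀ c, AccurateForJacobian ε H O (D c) (C.state κ (jacobianParams κ θ c))) ∧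
              ∀ k n, ‖jacobianEstimate κ h H O D k n
                - C.jacobian κ (hamiltonian h H) O θ k n‖ ≤ 14 * κ * (∑ a, |h a|) * ε} ∧
          (ν ≤ Nc → 1 - δ ≤ (jacobianLaw K B C κ θ).real
            {D | (∀ c, AccurateForJacobian ε H O (D c) (C.state κ (jacobianParams κ θ c))) ∧
              ∀ k n, ‖jacobianEstimate κ h H O D k n
                - C.jacobian κ (hamiltonian h H) O θ k n‖ ≤ 14 * κ * (∑ a, |h a|) * ε}) := by
  have hr' : (1 : ℝ) ≤ r := by exact_mod_cast hr
  have hNc' : (1 : ℝ) ≤ Nc := by exact_mod_cast hNc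
  have hrN : (1 : ℝ) ≤ r * Nc := one_le_mul_of_one_le_of_one_le hr' hNc'
  have hε2 : 0 < ε ^ 2 := by positivity
  have hA : ∀ l : ℕ, (1 : ℝ) ≤ 3 ^ l / ε ^ 2 := fun l => by
    rw [one_le_div hε2]
    exact (pow_le_one₀ hε.le hε1).trans (one_le_pow₀ (by norm_num))
  have hxJ : (2 : ℝ) ≤ 6 * r * Nc / δ := by
    rw [le_div_iff₀ hδ]; nlinarith
  have hxG : (2 : ℝ) ≤ 2 * r / δ := by
    rw [le_div_iff₀ hδ]; nlinarith
  obtain ⟨K, B, hK, hB, hKL, hBA, hKB, -⟩ := exists_batches (hA (p + q)) (two_thirds_le_log hxJ)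
  obtain ⟨K', B', hK', hB', hKL', hBA', hKB', hKB''⟩ :=
    exists_batches (hA p) (two_thirds_le_log hxG)
  have hlB : (11 : ℝ) * 3 ^ (p + q) ≤ B * ε ^ 2 := by
    rwa [← mul_div_assoc, div_le_iff₀ hε2] at hBA
  have hlB' : (11 : ℝ) * 3 ^ p ≤ B' * ε ^ 2 := by
    rwa [← mul_div_assoc, div_le_iff₀ hε2] at hBA'
  have hτ := exp_neg_half_le_of_log_le (by linarith) hKL
  have hτ' := exp_neg_half_le_of_log_le (by linarith) hKL'
  have hJ : (((2 * ν + 1) * (K * B) : ℕ) : ℝ) ≤ jacobianCost p q r Nc ν ε δ := by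
    push_cast
    calc (2 * (ν : ℝ) + 1) * (K * B)
        ≤ (2 * ν + 1) * (68 * (3 ^ (p + q) / ε ^ 2) * Real.log (6 * r * Nc / δ)) := by gcongr
      _ = _ := by rw [jacobianCost]; ring
  have hG : (((2 * ν) * (K' * B') : ℕ) : ℝ) ≤ gradientCost p r ν ε δ := by
    push_cast
    calc 2 * (ν : ℝ) * (K' * B')
        ≤ 2 * ν * (68 * (3 ^ p / ε ^ 2) * Real.log (2 * r / δ)) := by gcongr
      _ = _ := by rw [gradientCost]; ring
  -- rounding `K'` and `B'` loses at most the factor `60 / 68`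
  have hG' : gradientCost p r ν ε δ ≤ 17 / 15 * (((2 * ν) * (K' * B') : ℕ) : ℝ) := by
    push_cast
    calc gradientCost p r ν ε δ
        = 2 * ν * (17 / 15 * (60 * (3 ^ p / ε ^ 2) * Real.log (2 * r / δ))) := by
          rw [gradientCost]; ring
      _ ≤ 2 * ν * (17 / 15 * (K' * B')) := by gcongr
      _ = 17 / 15 * (2 * ν * (K' * B')) := by ring
  have hlogb : 0 ≤ Real.logb 2 (6 * Nc) := Real.logb_nonneg (by norm_num) (by linarith)
  -- The failure probability of one application for the Jacobian is quadratic in `δ / (r Nc)`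
  -- up to the factor `4 r Nc`; this is what makes the union bound over the configurations work.
  have hfail : 4 * r * Nc * Real.exp (-(K / 2)) ≤ δ ^ 2 / (9 * (r * Nc)) := by
    calc 4 * r * Nc * Real.exp (-(K / 2)) ≤ 4 * r * Nc * ((6 * r * Nc / δ)⁻¹) ^ 2 := by gcongr
      _ = δ ^ 2 / (9 * (r * Nc)) := by field_simp; norm_num
  have hδ2 : δ ^ 2 ≤ δ := by nlinarith
  have hfail1 : δ ^ 2 / (9 * (r * Nc)) ≤ δ := by
    rw [div_le_iff₀ (by positivity)]; nlinarith
  have hfail' : r * Real.exp (-(K' / 2)) ≤ δ := by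
    calc r * Real.exp (-(K' / 2)) ≤ r * ((2 * r / δ)⁻¹) ^ 2 := by gcongr
      _ = δ ^ 2 / (4 * r) := by field_simp; norm_num
      _ ≤ δ := by rw [div_le_iff₀ (by positivity)]; nlinarith
  have hgrad : ∀ (N : ℕ) (H : Fin r → PauliString N) (_ : ∀ a, (H a).IsLocal p)
      (ψ : Bits N → ℂ), expect 1 ψ = 1 →
      1 - δ ≤ (shadowLaw K' B' ψ).real {D | AccurateForGradient ε H D ψ} := fun N H hH ψ hψ => by
    refine le_trans ?_ (le_shadowLaw_forall_accurate (fun a => (hH a).isScaledPauli) hψ hK' hB'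
      hε hlB')
    rw [Fintype.card_fin]
    linarith
  have hjac : ∀ (N : ℕ) (H : Fin r → PauliString N) (_ : ∀ a, (H a).IsLocal p)
      (O : Fin Nc → PauliString N) (_ : ∀ k, (O k).IsLocal q) (ψ : Bits N → ℂ), expect 1 ψ = 1 →
      1 - δ ^ 2 / (9 * (r * Nc)) ≤
        (shadowLaw K B ψ).real {D | AccurateForJacobian ε H O D ψ} := fun N H hH O hO ψ hψ =>
    (sub_le_sub_left hfail 1).trans
      (le_shadowLaw_accurateForJacobian hr hNc hH hO hψ hK hB hε hlB)
  -- Bernoulli's inequality, with `(2 ν + 1) / (9 r Nc) ≤ 1`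
  have hbern : ν ≤ Nc → 1 - δ ≤ (1 - δ ^ 2 / (9 * (r * Nc))) ^ (2 * ν + 1) := fun hνN => by
    have hb := one_add_mul_le_pow (a := -(δ ^ 2 / (9 * (r * Nc)))) (by linarith) (2 * ν + 1)
    rw [← sub_eq_add_neg] at hb
    refine le_trans ?_ hb
    have hνN' : (ν : ℝ) ≤ Nc := by exact_mod_cast hνN
    have hNcr : (Nc : ℝ) ≤ r * Nc := le_mul_of_one_le_left (by linarith) hr'
    have : ((2 * ν + 1 : ℕ) : ℝ) * (δ ^ 2 / (9 * (r * Nc))) ≤ δ := by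
      rw [← mul_div_assoc, div_le_iff₀ (by positivity), mul_comm δ]
      push_cast
      exact mul_le_mul (by linarith) hδ2 (by positivity) (by positivity)
    linarith
  refine ⟨K, B, K', B', hJ, hG, fun hν => jacobianCost_le hr hNc hν hδ hδ1, fun hν => ?_,
    fun N C κ hκ θ h H hH => ⟨⟨fun n => (C.hasDerivAt_energy hκ θ h H n).differentiableAt,
      le_gradientLaw_coord C κ θ H (hgrad N H hH),
      pow_le_gradientLaw C hκ θ h H (by linarith) (hgrad N H hH)⟩, fun O hO => ?_⟩⟩
  · calc (((2 * ν + 1) * (K * B) : ℕ) : ℝ)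
        ≤ 3 / 2 * 3 ^ q * Real.logb 2 (6 * Nc) * gradientCost p r ν ε δ :=
          hJ.trans (jacobianCost_le hr hNc hν hδ hδ1)
      _ ≤ 3 / 2 * 3 ^ q * Real.logb 2 (6 * Nc) * (8 / 3 * (((2 * ν) * (K' * B') : ℕ) : ℝ)) := by
          gcongr
          exact hG'.trans (mul_le_mul_of_nonneg_right (by norm_num) (Nat.cast_nonneg _))
      _ = _ := by ring
  · have hjac' := fun ψ hψ => (sub_le_sub_left hfail1 1).trans (hjac N H hH O hO ψ hψ)
    exact ⟨fun k n => (C.hasDerivAt_covarFun hκ θ h hH (hO k) n).differentiableAt,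
      le_jacobianLaw_coord C κ θ H O hjac',
      pow_le_jacobianLaw C hκ θ h hH hO hε hε1 (by linarith) hjac',
      fun hνN => (hbern hνN).trans
        (pow_le_jacobianLaw C hκ θ h hH hO hε hε1 (by linarith) (hjac N H hH O hO))⟩
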